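/- **Setting.** Let $\Omega\subset\mathbb R^2$ be a bounded polygonal domain, $\Gamma_D\subset\partial\Omega$ the Dirichlet boundary and $\Gamma_N=\partial\Omega\setminus\Gamma_D$. Let $\gamma_1$ (barrier) and $\gamma_2$ (fracture) be disjoint oriented simple polygonal curves that meet $\partial\Omega$ at most in their endpoints and have no tips inside $\Omega$, and that divide $\Omega$ into three subdomains $\Omega_1,\Omega_2,\Omega_3$: $\gamma_1$ separates $\Omega_1$ from $\Omega_2$, and $\gamma_2$ separates $\Omega_2$ (the $-$ side) from $\Omega_3$ (the $+$ side). Let $\mathcal T_h$ be a conforming, shape-regular triangulation of $\Omega$, fitted to $\gamma_1$, $\gamma_2$, $\Gamma_D$, $\Gamma_N$, with mesh size $h$. Let $\mathcal E^{\gamma_i}$ be the set of edges on $\gamma_i$, $\mathcal E^D$ the set of edges on $\Gamma_D$, $\mathcal E^0$ the set of interior edges not on $\gamma_1\cup\gamma_2$, and put $\mathcal E^*=\mathcal E^0\cup\mathcal E^D\cup\mathcal E^{\gamma_2}$. Let $\mathcal V^\circ$ and $\mathcal V^D$ be the sets of mesh vertices on $\gamma_2$ that lie in $\Omega$ and in $\overline{\Gamma_D}$,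 respectively. Let $V_{h,k}$ be the space of functions on $\Omega$ whose restriction to each $T\in\mathcal T_h$ is a polynomial of total degree at most $k$. On an edge shared by $T_1,T_2$ with outer unit normals $\mathbf n_1,\mathbf n_2$ put $\{w\}=\frac12(w_1+w_2)$ and $[\![v]\!]=v_1\mathbf n_1+v_2\mathbf n_2$; on a boundary edge $\{w\}=w$ and $[\![v]\!]=v\mathbf n$. Let $\nu$ be the unit tangent of $\gamma_2$. For $P\in\mathcal V^\circ$ let $e_1,e_2$ be the edges of $\gamma_2$ arriving at and departing from $P$ (in the direction of $\nu$) and $T_i^\pm$ the triangle on the $\pm$ side having the side $e_i$; put $\{w\}_{P_\pm}=\frac12(w|_{T_1^\pm}+w|_{T_2^\pm})(P)$, $[\![v]\!]_{P_\pm}=(v|_{T_1^\pm}-v|_{T_2^\pm})(P)$. (At a corner of $\gamma_2$ each tangential derivative is taken along the edge concerned.) For $P\in\mathcal V^D$, an end of the fracture edge $e$ with adjacent triangles $T^\pm$, put $\{w\}_{P_\pm}=w|_{T^\pm}(P)$, $[\![v]\!]_{P_\pm}=\operatorname{sign}(\nu\cdot\mathbf n)\,v|_{T^\pm}(P)$,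 where $\operatorname{sign}(x)=1$ for $x\ge0$ and $-1$ for $x<0$ (at a corner of $\Omega$, $\mathbf n$ is the outer normal of either adjacent boundary edge). Let $\mathbf K_m$ be a measurable matrix field, given on each closed triangle (so that it has traces on the edges from each side); let $a,k_b,k_f$ be measurable, with $a>0$ on $\gamma_1\cup\gamma_2$, $k_b\ge0$ on $\gamma_1$ and $k_b/a$ integrable on $\gamma_1$. Let $\sigma\in\{-1,0,1\}$, $\alpha_0,\tilde\alpha_0>0$, and put $\alpha|_e=\alpha_0k^2|e|^{-1}$, $\tilde\alpha|_P=\tilde\alpha_0k^2\min(|e_1|,|e_2|)^{-1}$ for $P\in\mathcal V^\circ$ and $\tilde\alpha|_P=\tilde\alpha_0k^2|e|^{-1}$ for $P\in\mathcal V^D$. Define $$\begin{aligned}a_h(u,v)={}&\sum_{T\in\mathcal T_h}\int_T\mathbf K_m\nabla u\cdot\nabla v-\sum_{e\in\mathcal E^*}\int_e\{\mathbf K_m\nabla u\}\cdot[\![v]\!]+\sigma\sum_{e\in\mathcal E^*}\int_e[\![u]\!]\cdot\{\mathbf K_m\nabla v\}\\&+\sum_{e\in\mathcal E^*}\int_e\alpha[\![u]\!]\cdot[\![v]\!]+\sum_{e\in\mathcal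 E^{\gamma_1}}\int_e\tfrac{k_b}{a}[\![u]\!]\cdot[\![v]\!],\end{aligned}$$ $$\begin{aligned}b_h(u,v)=\sum_{s\in\{-,+\}}\Big(&\tfrac12\sum_{e\in\mathcal E^{\gamma_2}}\int_e ak_f\,\partial_\nu u^s\,\partial_\nu v^s-\tfrac12\sum_{P\in\mathcal V^\circ\cup\mathcal V^D}ak_f\{\partial_\nu u\}_{P_s}[\![v]\!]_{P_s}\\&+\tfrac\sigma2\sum_{P\in\mathcal V^\circ\cup\mathcal V^D}ak_f\{\partial_\nu v\}_{P_s}[\![u]\!]_{P_s}+\sum_{P\in\mathcal V^\circ\cup\mathcal V^D}\tilde\alpha[\![u]\!]_{P_s}[\![v]\!]_{P_s}\Big),\end{aligned}$$ $$\begin{aligned}\|v\|_{DG}^2={}&\sum_{T\in\mathcal T_h}\int_T|\nabla v|^2+\sum_{e\in\mathcal E^*}\int_e\alpha\,|[\![v]\!]|^2+\sum_{e\in\mathcal E^{\gamma_1}}\int_e\tfrac{k_b}{a}|[\![v]\!]|^2\\&+\sum_{s\in\{-,+\}}\Big(\sum_{e\in\mathcal E^{\gamma_2}}\int_e|\partial_\nu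 v^s|^2+\sum_{P\in\mathcal V^\circ\cup\mathcal V^D}\tilde\alpha\,[\![v]\!]_{P_s}^2\Big).\end{aligned}$$ **Theorem (stability).** Let $\theta,\Theta>0$ and let $\varrho$ be a shape-regularity constant. There are positive thresholds $A,\tilde A$ and positive constants $C_1,C_2$, depending only on $\theta,\Theta,\varrho$ (in particular not on $h$ or on $k$), such that for all data as above with $h_T\le\varrho\, r_T$ for every $T\in\mathcal T_h$ ($h_T$ the diameter and $r_T$ the inradius of $T$), with $\mathbf K_m$ symmetric, $\theta\mathbf I\le\mathbf K_m\le\Theta\mathbf I$ on every closed triangle and $\theta\le ak_f\le\Theta$ on $\gamma_2$, for every $k\ge 0$, and for all $\alpha_0\ge A$ and $\tilde\alpha_0\ge\tilde A$, $$|a_h(u,v)+b_h(u,v)|\le C_1\|u\|_{DG}\|v\|_{DG}\quad\text{and}\quad a_h(u,u)+b_h(u,u)\ge C_2\|u\|_{DG}^2\qquad\text{for all }u,v\in V_{h,k}.$$ -/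

import Mathlib

open MeasureTheory

noncomputable section


section

open scoped Classical

/-- The Euclidean plane `ℝ²`. -/
abbrev Plane : Type := EuclideanSpace ℝ (Fin 2)

/-- The closed convex cell (triangle, edge) spanned by a finite set of vertices. -/
def hull (s : Finset Plane) : Set Plane := convexHull ℝ (s : Set Plane)

/-! ### Triangular meshes -/

/-- A conforming triangulation of the closure of `Ω`: a finite set of nondegenerate triangles,
each given by the set of its three vertices, any two of which meet exactly in the hull of their
common vertices (nothing, a common vertex or a common side). -/
structure TriMesh (Ω : Set Plane) where
  cells : Finset (Finset Plane)
  card_eq : ∀ T ∈ cells, T.card = 3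
  indep : ∀ T ∈ cells, AffineIndependent ℝ ((↑) : T → Plane)
  conforming : ∀ T ∈ cells, ∀ T' ∈ cells, hull T ∩ hull T' = hull (T ∩ T')
  cover : (⋃ T ∈ cells, hull T) = closure Ω

namespace TriMesh

variable {Ω : Set Plane} (M : TriMesh Ω)

/-- All sides of triangles, each given by the set of its two endpoints. -/
def edges : Finset (Finset Plane) := M.cells.biUnion fun T => T.powersetCard 2

/-- The triangles that have `e` as a side. -/
def cellsAt (e : Finset Plane) : Finset (Finset Plane) := M.cells.filter fun T => e ⊆ T

/-- Edges shared by two triangles. -/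
def interiorEdges : Finset (Finset Plane) := M.edges.filter fun e => (M.cellsAt e).card = 2

/-- Edges that belong to one triangle only; they lie on the boundary of `Ω`. -/
def boundaryEdges : Finset (Finset Plane) := M.edges.filter fun e => (M.cellsAt e).card = 1

/-- Shape regularity with constant `ϱ`: the diameter `h_T` of each triangle `T` is at most `ϱ`
times the radius of a disc contained in `T`. -/
def ShapeRegular (ϱ : ℝ) : Prop :=
  ∀ T ∈ M.cells, ∃ (x : Plane) (r : ℝ), 0 < r ∧ Metric.closedBall x r ⊆ hull T ∧
    Metric.diam (hull T) ≤ ϱ * r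

/-- The DG space `V_{h,k}`: one polynomial of total degree at most `k` for each triangle, with no
continuity across edges. The component `v T` provides the values of the function on the triangle
`T` and its traces on `∂T` (components outside `M.cells` are irrelevant). -/
def DGSpace (k : ℕ) : Set (Finset Plane → MvPolynomial (Fin 2) ℝ) :=
  {v | ∀ T ∈ M.cells, (v T).totalDegree ≤ k}

end TriMesh

/-- The length of the edge with endpoint set `e`. -/
def edgeLength (e : Finset Plane) : ℝ := Metric.diam (e : Set Plane)

/-- The integral along the edge `e` with respect to arc length
(the one-dimensional Hausdorff measure). -/
def edgeIntegral (e : Finset Plane) (f : Plane → ℝ) : ℝ :=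
  ∫ x in hull e, f x ∂(Measure.hausdorffMeasure 1 : Measure Plane)

/-- The unit normal on the side `e` of the triangle `T` pointing out of `T`: the normalized
component orthogonal to `e` of the vector from the barycentre of `T` to the midpoint of `e`. -/
def outerNormal (T e : Finset Plane) : Plane :=
  let w : Plane := (vectorSpan ℝ (e : Set Plane))ᗮ.starProjection
    ((1 / 2 : ℝ) • (∑ x ∈ e, x) - (1 / 3 : ℝ) • ∑ x ∈ T, x)
  ‖w‖⁻¹ • w

/-- The value of a polynomial at a point of the plane. -/
def pval (p : MvPolynomial (Fin 2) ℝ) (x : Plane) : ℝ := MvPolynomial.eval (fun i => x i) p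

/-- The gradient of a polynomial at a point of the plane. -/
def pgrad (p : MvPolynomial (Fin 2) ℝ) (x : Plane) : Plane :=
  WithLp.toLp 2 fun i => pval (MvPolynomial.pderiv i p) x

/-! ### Barriers and fractures resolved by the mesh -/

/-- The undirected edge underlying a directed edge `(tail, head)`. -/
def edgeOf (o : Plane × Plane) : Finset Plane := {o.1, o.2}

/-- The unit tangential vector `ν` of a directed edge. -/
def tangent (o : Plane × Plane) : Plane := ‖o.2 - o.1‖⁻¹ • (o.2 - o.1)

/-- An oriented polygonal curve made of interior edges of the mesh, without self-intersections and
without tips in the interior of `Ω`: at each of its vertices in `Ω` exactly one directed edge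
arrives and exactly one departs, and each of its vertices on `∂Ω` is an end of exactly one edge. -/
structure MeshCurve {Ω : Set Plane} (M : TriMesh Ω) where
  dirEdges : Finset (Plane × Plane)
  isEdge : ∀ o ∈ dirEdges, edgeOf o ∈ M.interiorEdges
  oriented : ∀ o ∈ dirEdges, o.swap ∉ dirEdges
  inner : ∀ o ∈ dirEdges, ∀ P ∈ edgeOf o, P ∈ Ω →
    (∃! o₁, o₁ ∈ dirEdges ∧ o₁.2 = P) ∧ (∃! o₂, o₂ ∈ dirEdges ∧ o₂.1 = P)
  outer : ∀ o ∈ dirEdges, ∀ P ∈ edgeOf o, P ∉ Ω →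
    ∃! o', o' ∈ dirEdges ∧ P ∈ edgeOf o'

namespace MeshCurve

variable {Ω : Set Plane} {M : TriMesh Ω} (γ : MeshCurve M)

/-- The point set of the curve. -/
def carrier : Set Plane := ⋃ o ∈ γ.dirEdges, hull (edgeOf o)

/-- The mesh edges on the curve. -/
def edges : Finset (Finset Plane) := γ.dirEdges.image edgeOf

/-- The vertices of the curve in `Ω`, each listed as the pair `(e₁, e₂)` of the directed edge that
arrives at the vertex and the directed edge that departs from it. -/
def joints : Finset ((Plane × Plane) × (Plane × Plane)) :=
  (γ.dirEdges ×ˢ γ.dirEdges).filter fun p => p.1.2 = p.2.1 ∧ p.1.2 ∈ Ω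

/-- The vertices of the curve on the part `closure ΓD` of `∂Ω`, each listed as the pair `(e, P)` of
the directed edge ending there and the vertex. -/
def tips (ΓD : Set Plane) : Finset ((Plane × Plane) × Plane) :=
  (γ.dirEdges.biUnion fun o => (edgeOf o).image fun P => (o, P)).filter
    fun p => p.2 ∉ Ω ∧ p.2 ∈ closure ΓD

end MeshCurve

/-- A fractured polygonal domain together with a fitted triangular mesh. -/
structure FracturedMesh where
  /-- the domain -/
  Ω : Set Plane
  isOpen_Ω : IsOpen Ω
  isConnected_Ω : IsConnected Ω
  /-- `Ω` lies on one side of its boundary (no slits) -/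
  regular_Ω : interior (closure Ω) = Ω
  /-- the Dirichlet boundary; the Neumann boundary is `frontier Ω \ ΓD` -/
  ΓD : Set Plane
  ΓD_subset : ΓD ⊆ frontier Ω
  mesh : TriMesh Ω
  /-- each boundary edge is a Dirichlet edge or a Neumann edge, up to its endpoints -/
  ΓD_fitted : ∀ e ∈ mesh.boundaryEdges,
    intrinsicInterior ℝ (hull e) ⊆ ΓD ∨ intrinsicInterior ℝ (hull e) ⊆ frontier Ω \ ΓD
  /-- the blocking barrier -/
  γ₁ : MeshCurve mesh
  /-- the conductive fracture -/
  γ₂ : MeshCurve mesh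
  γ_disjoint : Disjoint γ₁.carrier γ₂.carrier
  /-- the three subdomains -/
  Ω₁ : Set Plane
  Ω₂ : Set Plane
  Ω₃ : Set Plane
  isOpen_Ω₁ : IsOpen Ω₁
  isOpen_Ω₂ : IsOpen Ω₂
  isOpen_Ω₃ : IsOpen Ω₃
  isConnected_Ω₁ : IsConnected Ω₁
  isConnected_Ω₂ : IsConnected Ω₂
  isConnected_Ω₃ : IsConnected Ω₃
  disjoint₁₂ : Disjoint Ω₁ Ω₂
  disjoint₁₃ : Disjoint Ω₁ Ω₃
  disjoint₂₃ : Disjoint Ω₂ Ω₃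
  union_eq : Ω₁ ∪ Ω₂ ∪ Ω₃ = Ω \ (γ₁.carrier ∪ γ₂.carrier)
  /-- the barrier separates `Ω₁` from `Ω₂` -/
  γ₁_sides : ∀ o ∈ γ₁.dirEdges,
    (∃ T ∈ mesh.cellsAt (edgeOf o), interior (hull T) ⊆ Ω₁) ∧
    (∃ T ∈ mesh.cellsAt (edgeOf o), interior (hull T) ⊆ Ω₂)
  /-- the triangle `T⁻` in `Ω₂` adjacent to a given edge of the fracture -/
  cellMinus : Plane × Plane → Finset Plane
  cellMinus_spec : ∀ o ∈ γ₂.dirEdges,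
    cellMinus o ∈ mesh.cellsAt (edgeOf o) ∧ interior (hull (cellMinus o)) ⊆ Ω₂
  /-- the triangle `T⁺` in `Ω₃` adjacent to a given edge of the fracture -/
  cellPlus : Plane × Plane → Finset Plane
  cellPlus_spec : ∀ o ∈ γ₂.dirEdges,
    cellPlus o ∈ mesh.cellsAt (edgeOf o) ∧ interior (hull (cellPlus o)) ⊆ Ω₃
  /-- the unit outer normal of `∂Ω` at the tips of the fracture (at a corner of `Ω`, the normal of
  either of the adjacent boundary edges may be used) -/
  tipNormal : Plane → Plane
  tipNormal_spec : ∀ p ∈ γ₂.tips ΓD, ∃ e ∈ mesh.boundaryEdges, p.2 ∈ e ∧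
    ∃ T ∈ mesh.cellsAt e, tipNormal p.2 = outerNormal T e

/-- The coefficients of the model: `K T` is the permeability tensor of the bulk matrix on the closed
triangle `T`, so that its values on `∂T` are the traces taken from `T`; `a` is the aperture, `kb` the
permeability of the barrier and `kf` the permeability of the fracture. -/
structure Coefficients where
  K : Finset Plane → Plane → Matrix (Fin 2) (Fin 2) ℝ
  a : Plane → ℝ
  kb : Plane → ℝ
  kf : Plane → ℝ

/-- The assumptions on the coefficients: `θ I ≤ K ≤ Θ I` as symmetric matrices on each closed
triangle, `θ ≤ a kf ≤ Θ` on the fracture, and on the barrier `a > 0`, `kb ≥ 0` and `kb / a` is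
integrable. -/
structure Coefficients.Admissible (c : Coefficients) (D : FracturedMesh) (θ Θ : ℝ) : Prop where
  measurable_K : ∀ T ∈ D.mesh.cells, ∀ i j, Measurable fun x => c.K T x i j
  measurable_a : Measurable c.a
  measurable_kb : Measurable c.kb
  measurable_kf : Measurable c.kf
  K_lower : ∀ T ∈ D.mesh.cells, ∀ x ∈ hull T,
    (c.K T x - θ • (1 : Matrix (Fin 2) (Fin 2) ℝ)).PosSemidef
  K_upper : ∀ T ∈ D.mesh.cells, ∀ x ∈ hull T,
    (Θ • (1 : Matrix (Fin 2) (Fin 2) ℝ) - c.K T x).PosSemidef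
  a_pos : ∀ x ∈ D.γ₁.carrier ∪ D.γ₂.carrier, 0 < c.a x
  kb_nonneg : ∀ x ∈ D.γ₁.carrier, 0 ≤ c.kb x
  kb_div_a : ∀ e ∈ D.γ₁.edges,
    IntegrableOn (fun x => c.kb x / c.a x) (hull e) (Measure.hausdorffMeasure 1)
  akf_lower : ∀ x ∈ D.γ₂.carrier, θ ≤ c.a x * c.kf x
  akf_upper : ∀ x ∈ D.γ₂.carrier, c.a x * c.kf x ≤ Θ

/-! ### Averages, jumps and penalty functions -/

/-- The flux `K ∇v` of a discrete function on the triangle `T`. -/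
def flux (c : Coefficients) (v : Finset Plane → MvPolynomial (Fin 2) ℝ) (T : Finset Plane)
    (x : Plane) : Plane :=
  WithLp.toLp 2 ((c.K T x).mulVec fun i => pgrad (v T) x i)

/-- The penalty function `α = α₀ k² / |e|` on the edge `e`. -/
def penalty (α₀ : ℝ) (k : ℕ) (e : Finset Plane) : ℝ := α₀ * (k : ℝ) ^ 2 / edgeLength e

/-- The penalty function at a vertex of the fracture in `Ω`: `α̃₀ k² / min (|e₁|, |e₂|)`. -/
def penaltyJoint (α₀' : ℝ) (k : ℕ) (p : (Plane × Plane) × (Plane × Plane)) : ℝ :=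
  α₀' * (k : ℝ) ^ 2 / min (edgeLength (edgeOf p.1)) (edgeLength (edgeOf p.2))

/-- The penalty function at a vertex of the fracture on the Dirichlet boundary: `α̃₀ k² / |e|`. -/
def penaltyTip (α₀' : ℝ) (k : ℕ) (p : (Plane × Plane) × Plane) : ℝ :=
  α₀' * (k : ℝ) ^ 2 / edgeLength (edgeOf p.1)

/-- The sign function with value `1` at `0`. -/
def signum (x : ℝ) : ℝ := if 0 ≤ x then 1 else -1

/-- The tangential derivative along the directed edge `o` of the polynomial `p`. -/
def tderiv (o : Plane × Plane) (p : MvPolynomial (Fin 2) ℝ) (x : Plane) : ℝ :=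
  inner ℝ (pgrad p x) (tangent o)

/-- The average of tangential derivatives at a vertex of the fracture in `Ω`, from the side of the
fracture on which the triangle `cell o` is adjacent to the edge `o`. -/
def avgJoint (cell : Plane × Plane → Finset Plane) (v : Finset Plane → MvPolynomial (Fin 2) ℝ)
    (p : (Plane × Plane) × (Plane × Plane)) : ℝ :=
  (1 / 2) * (tderiv p.1 (v (cell p.1)) p.1.2 + tderiv p.2 (v (cell p.2)) p.1.2)

/-- The jump at a vertex of the fracture in `Ω`, from one side of the fracture. -/
def jumpJoint (cell : Plane × Plane → Finset Plane) (v : Finset Plane → MvPolynomial (Fin 2) ℝ)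
    (p : (Plane × Plane) × (Plane × Plane)) : ℝ :=
  pval (v (cell p.1)) p.1.2 - pval (v (cell p.2)) p.1.2

/-- The average (that is, the value) of the tangential derivative at a vertex of the fracture on the
Dirichlet boundary, from one side of the fracture. -/
def avgTip (cell : Plane × Plane → Finset Plane) (v : Finset Plane → MvPolynomial (Fin 2) ℝ)
    (p : (Plane × Plane) × Plane) : ℝ :=
  tderiv p.1 (v (cell p.1)) p.2

namespace FracturedMesh

variable (D : FracturedMesh)

/-- The Dirichlet edges. -/
def dirichletEdges : Finset (Finset Plane) :=
  D.mesh.boundaryEdges.filter fun e => intrinsicInterior ℝ (hull e) ⊆ D.ΓD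

/-- The interior edges that lie neither on the barrier nor on the fracture. -/
def ordinaryEdges : Finset (Finset Plane) :=
  D.mesh.interiorEdges \ (D.γ₁.edges ∪ D.γ₂.edges)

/-- The edges that carry flux and penalty terms: the ordinary interior edges, the Dirichlet edges and
the edges of the fracture. -/
def fluxEdges : Finset (Finset Plane) := D.ordinaryEdges ∪ D.dirichletEdges ∪ D.γ₂.edges

/-- The jump of `v` on the edge `e`: `v₁ n₁ + v₂ n₂` on an interior edge, `v n` on a boundary edge. -/
def jump (v : Finset Plane → MvPolynomial (Fin 2) ℝ) (e : Finset Plane) (x : Plane) : Plane :=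
  ∑ T ∈ D.mesh.cellsAt e, pval (v T) x • outerNormal T e

/-- The average of the flux `K ∇v` on the edge `e`: the mean of the two traces on an interior edge,
the trace itself on a boundary edge. -/
def avgFlux (c : Coefficients) (v : Finset Plane → MvPolynomial (Fin 2) ℝ) (e : Finset Plane)
    (x : Plane) : Plane :=
  ((D.mesh.cellsAt e).card : ℝ)⁻¹ • ∑ T ∈ D.mesh.cellsAt e, flux c v T x

/-- The jump at a vertex of the fracture on the Dirichlet boundary, from one side. -/
def jumpTip (cell : Plane × Plane → Finset Plane) (v : Finset Plane → MvPolynomial (Fin 2) ℝ)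
    (p : (Plane × Plane) × Plane) : ℝ :=
  signum (inner ℝ (tangent p.1) (D.tipNormal p.2)) * pval (v (cell p.1)) p.2

/-- The bilinear form `a_h`. -/
def aForm (c : Coefficients) (σ α₀ : ℝ) (k : ℕ)
    (u v : Finset Plane → MvPolynomial (Fin 2) ℝ) : ℝ :=
  (∑ T ∈ D.mesh.cells, ∫ x in hull T, inner ℝ (flux c u T x) (pgrad (v T) x))
    - (∑ e ∈ D.fluxEdges, edgeIntegral e fun x => inner ℝ (D.avgFlux c u e x) (D.jump v e x))
    + σ * (∑ e ∈ D.fluxEdges, edgeIntegral e fun x => inner ℝ (D.jump u e x) (D.avgFlux c v e x))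
    + (∑ e ∈ D.fluxEdges, edgeIntegral e fun x =>
        penalty α₀ k e * inner ℝ (D.jump u e x) (D.jump v e x))
    + ∑ e ∈ D.γ₁.edges, edgeIntegral e fun x =>
        c.kb x / c.a x * inner ℝ (D.jump u e x) (D.jump v e x)

/-- The vertex sum `[akf {∂u/∂ν}, ⟦v⟧]` over the vertices of the fracture in `Ω` and on the Dirichlet
boundary, taken from one side of the fracture. -/
def vertexFlux (c : Coefficients) (cell : Plane × Plane → Finset Plane)
    (u v : Finset Plane → MvPolynomial (Fin 2) ℝ) : ℝ :=
  (∑ p ∈ D.γ₂.joints, c.a p.1.2 * c.kf p.1.2 * avgJoint cell u p * jumpJoint cell v p)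
    + ∑ p ∈ D.γ₂.tips D.ΓD, c.a p.2 * c.kf p.2 * avgTip cell u p * D.jumpTip cell v p

/-- The vertex sum `[α̃ ⟦u⟧, ⟦v⟧]` over the vertices of the fracture in `Ω` and on the Dirichlet
boundary, taken from one side of the fracture. -/
def vertexPenalty (α₀' : ℝ) (k : ℕ) (cell : Plane × Plane → Finset Plane)
    (u v : Finset Plane → MvPolynomial (Fin 2) ℝ) : ℝ :=
  (∑ p ∈ D.γ₂.joints, penaltyJoint α₀' k p * jumpJoint cell u p * jumpJoint cell v p)
    + ∑ p ∈ D.γ₂.tips D.ΓD, penaltyTip α₀' k p * D.jumpTip cell u p * D.jumpTip cell v p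

/-- The terms of the bilinear form `b_h` that come from one side of the fracture. -/
def bSide (c : Coefficients) (σ α₀' : ℝ) (k : ℕ) (cell : Plane × Plane → Finset Plane)
    (u v : Finset Plane → MvPolynomial (Fin 2) ℝ) : ℝ :=
  (1 / 2) * (∑ o ∈ D.γ₂.dirEdges, edgeIntegral (edgeOf o) fun x =>
      c.a x * c.kf x * tderiv o (u (cell o)) x * tderiv o (v (cell o)) x)
    - (1 / 2) * D.vertexFlux c cell u v
    + σ / 2 * D.vertexFlux c cell v u
    + D.vertexPenalty α₀' k cell u v

/-- The bilinear form `b_h`. -/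
def bForm (c : Coefficients) (σ α₀' : ℝ) (k : ℕ)
    (u v : Finset Plane → MvPolynomial (Fin 2) ℝ) : ℝ :=
  D.bSide c σ α₀' k D.cellMinus u v + D.bSide c σ α₀' k D.cellPlus u v

/-- The squared `L²` norm on the fracture of the tangential derivative taken from one side. -/
def tangentialSq (cell : Plane × Plane → Finset Plane)
    (v : Finset Plane → MvPolynomial (Fin 2) ℝ) : ℝ :=
  ∑ o ∈ D.γ₂.dirEdges, edgeIntegral (edgeOf o) fun x => tderiv o (v (cell o)) x ^ 2

/-- The square of the DG norm. -/
def dgNormSq (c : Coefficients) (α₀ α₀' : ℝ) (k : ℕ)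
    (v : Finset Plane → MvPolynomial (Fin 2) ℝ) : ℝ :=
  (∑ T ∈ D.mesh.cells, ∫ x in hull T, ‖pgrad (v T) x‖ ^ 2)
    + (∑ e ∈ D.fluxEdges, edgeIntegral e fun x => penalty α₀ k e * ‖D.jump v e x‖ ^ 2)
    + (∑ e ∈ D.γ₁.edges, edgeIntegral e fun x => c.kb x / c.a x * ‖D.jump v e x‖ ^ 2)
    + D.tangentialSq D.cellMinus v + D.tangentialSq D.cellPlus v
    + D.vertexPenalty α₀' k D.cellMinus v v + D.vertexPenalty α₀' k D.cellPlus v v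

/-- The DG norm. -/
def dgNorm (c : Coefficients) (α₀ α₀' : ℝ) (k : ℕ)
    (v : Finset Plane → MvPolynomial (Fin 2) ℝ) : ℝ :=
  √(D.dgNormSq c α₀ α₀' k v)

end FracturedMesh

end

end

/-! ### The inverse trace inequality on an interval -/

section Interval

open Polynomial intervalIntegral

/-- The polynomial of degree less than `k` that represents the evaluation at `0` on polynomials of
degree less than `k` in `L²(0, 1)`: its coefficients, described by its moments. -/
theorem exists_coeff_moments (k : ℕ) (hk : 0 < k) : ∃ c : ℕ → ℝ, c 0 = (k : ℝ) ^ 2 ∧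
    ∀ j < k, ∑ i ∈ Finset.range k, c i * ((i + j + 1 : ℝ))⁻¹ = if j = 0 then 1 else 0 := by
  obtain ⟨n, rfl⟩ : ∃ n, k = n + 1 := ⟨k - 1, by omega⟩
  set s := Finset.range (n + 1)
  let v : ℕ → ℝ := fun i => -((i : ℝ) + 1)
  have hv : Set.InjOn v s := fun i _ j _ h => by
    have : (i : ℝ) = j := by simpa [v] using h
    exact_mod_cast this
  let P : ℝ[X] := C ((n : ℝ) + 1) * ∏ j ∈ Finset.range n, (C ((j : ℝ) + 1) - X)
  have hdeg : P.degree < s.card := by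
    have h1 : (∏ j ∈ Finset.range n, (C ((j : ℝ) + 1) - X)).natDegree ≤ n := by
      refine (natDegree_prod_le _ _).trans ?_
      refine (Finset.sum_le_card_nsmul _ _ 1 fun j _ => ?_).trans (by simp)
      exact (natDegree_sub_le _ _).trans
        (max_le ((natDegree_C _).le.trans zero_le_one) natDegree_X_le)
    have h2 : P.natDegree ≤ n := (natDegree_C_mul_le _ _).trans h1
    refine (degree_le_natDegree.trans (Nat.cast_le.2 h2)).trans_lt ?_
    simp only [s, Finset.card_range]
    exact_mod_cast Nat.lt_succ_self n
  have hP : ∀ x, P.eval x = (n + 1) * ∏ j ∈ Finset.range n, ((j : ℝ) + 1 - x) := fun x => by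
    simp [P, eval_prod]
  have hnode : ∀ j : ℕ, P.eval (j : ℝ) = (Lagrange.nodal s v).eval (j : ℝ) *
      ∑ i ∈ s, (Lagrange.nodalWeight s v i * P.eval (v i)) * ((i + j + 1 : ℝ))⁻¹ := fun j => by
    conv_lhs => rw [Lagrange.eq_interpolate hv hdeg]
    rw [Lagrange.eval_interpolate_not_at_node]
    · congr 1
      refine Finset.sum_congr rfl fun i _ => ?_
      have : (j : ℝ) - v i = i + j + 1 := by simp only [v]; ring
      rw [this]; ring
    · intro i _ h
      have : (j : ℝ) = -((i : ℝ) + 1) := h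
      have h1 : (0 : ℝ) ≤ j := Nat.cast_nonneg j
      have h2 : (0 : ℝ) ≤ i := Nat.cast_nonneg i
      linarith
  have hnodal : ∀ j : ℕ, (Lagrange.nodal s v).eval (j : ℝ) = ∏ i ∈ s, ((i : ℝ) + j + 1) := by
    intro j
    rw [Lagrange.eval_nodal]
    exact Finset.prod_congr rfl fun i _ => by simp only [v]; ring
  have hnodal_ne : ∀ j : ℕ, (Lagrange.nodal s v).eval (j : ℝ) ≠ 0 := fun j => by
    rw [hnodal]; exact (Finset.prod_pos fun i _ => by positivity).ne'
  refine ⟨fun i => Lagrange.nodalWeight s v i * P.eval (v i), ?_, fun j hj => ?_⟩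
  · have hw : Lagrange.nodalWeight s v 0 = (∏ j ∈ Finset.range n, ((j : ℝ) + 1))⁻¹ := by
      rw [Lagrange.nodalWeight, ← Finset.prod_inv_distrib]
      have : s.erase 0 = (Finset.range n).map ⟨Nat.succ, Nat.succ_injective⟩ := by
        ext i; cases i <;> simp [s]
      rw [this, Finset.prod_map]
      refine Finset.prod_congr rfl fun j _ => ?_
      simp [v]
    have hv0 : P.eval (v 0) = (n + 1) * ∏ j ∈ Finset.range n, ((j : ℝ) + 2) := by
      rw [hP]; congr 1
      exact Finset.prod_congr rfl fun j _ => by simp only [v]; push_cast; ring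
    have hr : (∏ j ∈ Finset.range n, ((j : ℝ) + 2))
        = (n + 1) * ∏ j ∈ Finset.range n, ((j : ℝ) + 1) := by
      have h1 := Finset.prod_range_succ (fun j : ℕ => (j : ℝ) + 1) n
      rw [Finset.prod_range_succ' (fun j : ℕ => (j : ℝ) + 1) n] at h1
      simp only [Nat.cast_add, Nat.cast_one, Nat.cast_zero, zero_add, mul_one] at h1
      rw [mul_comm, ← h1]
      exact Finset.prod_congr rfl fun j _ => by ring
    have hne : (∏ j ∈ Finset.range n, ((j : ℝ) + 1)) ≠ 0 :=
      (Finset.prod_pos fun i _ => by positivity).ne'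
    simp only [hw, hv0, hr]
    field_simp
    push_cast
    ring
  · have h := hnode j
    refine mul_left_cancel₀ (hnodal_ne j) (h.symm.trans ?_)
    rw [hP]
    split_ifs with h0
    · subst h0
      rw [mul_one, hnodal]
      simp only [s, Finset.prod_range_succ]
      simp [mul_comm]
    · have : j - 1 ∈ Finset.range n := by simp only [Finset.mem_range]; omega
      rw [Finset.prod_eq_zero this, mul_zero, mul_zero]
      have : (j : ℝ) = ((j - 1 : ℕ) : ℝ) + 1 := by
        rw [← Nat.cast_add_one, Nat.sub_add_cancel (Nat.pos_of_ne_zero h0)]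
      linarith

theorem exists_evaluation_kernel (k : ℕ) (hk : 0 < k) : ∃ K : ℝ[X], K.degree < k ∧
    K.eval 0 = (k : ℝ) ^ 2 ∧
    ∀ p : ℝ[X], p.degree < k → ∫ t in (0 : ℝ)..1, K.eval t * p.eval t = p.eval 0 := by
  obtain ⟨c, hc0, hc⟩ := exists_coeff_moments k hk
  set K : ℝ[X] := ∑ i ∈ Finset.range k, C (c i) * X ^ i
  refine ⟨K, ?_, ?_, fun p hp => ?_⟩
  · refine mem_degreeLT.1 (Submodule.sum_mem _ fun i hi => mem_degreeLT.2 ?_)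
    exact (degree_C_mul_X_pow_le i _).trans_lt (by exact_mod_cast Finset.mem_range.1 hi)
  · rw [← hc0, eval_finsetSum, Finset.sum_eq_single 0]
    · simp
    · intro i _ hi; simp [hi]
    · intro h; exact absurd (Finset.mem_range.2 hk) h
  · have hpk : p.natDegree < k := by
      rcases eq_or_ne p 0 with rfl | h0
      · simpa using hk
      · exact (natDegree_lt_iff_degree_lt h0).2 hp
    have hpe : ∀ t, p.eval t = ∑ j ∈ Finset.range k, p.coeff j * t ^ j := fun t =>
      eval_eq_sum_range' hpk t
    have hint : ∀ j, IntervalIntegrable (fun t => K.eval t * (p.coeff j * t ^ j)) volume 0 1 :=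
      fun j => Continuous.intervalIntegrable (by fun_prop) _ _
    calc ∫ t in (0 : ℝ)..1, K.eval t * p.eval t
        = ∫ t in (0 : ℝ)..1, ∑ j ∈ Finset.range k, K.eval t * (p.coeff j * t ^ j) := by
          simp only [hpe, Finset.mul_sum]
      _ = ∑ j ∈ Finset.range k, ∫ t in (0 : ℝ)..1, K.eval t * (p.coeff j * t ^ j) :=
          integral_finsetSum fun j _ => hint j
      _ = ∑ j ∈ Finset.range k, p.coeff j * if j = 0 then 1 else 0 := by
          refine Finset.sum_congr rfl fun j hj => ?_
          rw [← hc j (Finset.mem_range.1 hj), Finset.mul_sum]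
          have : ∀ t : ℝ, K.eval t * (p.coeff j * t ^ j)
              = ∑ i ∈ Finset.range k, p.coeff j * c i * t ^ (i + j) := fun t => by
            simp only [K, eval_finsetSum, Finset.sum_mul]
            refine Finset.sum_congr rfl fun i _ => ?_
            simp; ring
          simp only [this]
          rw [integral_finsetSum fun i _ => Continuous.intervalIntegrable (by fun_prop) _ _]
          refine Finset.sum_congr rfl fun i _ => ?_
          rw [intervalIntegral.integral_const_mul, integral_pow]
          simp; ring
      _ = p.eval 0 := by
          rw [← coeff_zero_eq_eval_zero, Finset.sum_eq_single 0]
          · simp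
          · intro i _ hi; simp [hi]
          · intro h; exact absurd (Finset.mem_range.2 hk) h

/-- The sharp inverse trace inequality on the unit interval. -/
theorem sq_eval_zero_le (k : ℕ) (p : ℝ[X]) (hp : p.degree < k) :
    p.eval 0 ^ 2 ≤ (k : ℝ) ^ 2 * ∫ t in (0 : ℝ)..1, p.eval t ^ 2 := by
  rcases Nat.eq_zero_or_pos k with rfl | hk
  · have : p = 0 := by simpa using hp
    simp [this]
  obtain ⟨K, hK, hK0, hrep⟩ := exists_evaluation_kernel k hk
  have hk' : (0 : ℝ) < (k : ℝ) ^ 2 := by positivity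
  have h : (0 : ℝ) ≤ ∫ t in (0 : ℝ)..1, ((k : ℝ) ^ 2 * p.eval t - p.eval 0 * K.eval t) ^ 2 :=
    integral_nonneg zero_le_one fun t _ => sq_nonneg _
  have hI : ∀ q : ℝ[X], IntervalIntegrable (fun t => q.eval t) volume 0 1 := fun q =>
    q.continuous.intervalIntegrable _ _
  have e : (∫ t in (0 : ℝ)..1, ((k : ℝ) ^ 2 * p.eval t - p.eval 0 * K.eval t) ^ 2)
      = ((k : ℝ) ^ 2) ^ 2 * (∫ t in (0 : ℝ)..1, p.eval t ^ 2)
        - 2 * (k : ℝ) ^ 2 * p.eval 0 * (∫ t in (0 : ℝ)..1, K.eval t * p.eval t)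
        + p.eval 0 ^ 2 * ∫ t in (0 : ℝ)..1, K.eval t * K.eval t := by
    simp only [← intervalIntegral.integral_const_mul]
    rw [← intervalIntegral.integral_sub, ← intervalIntegral.integral_add]
    · congr 1; ext t; ring
    all_goals exact Continuous.intervalIntegrable (by fun_prop) _ _
  rw [e, hrep p hp, hrep K hK, hK0] at h
  have : 0 ≤ (k : ℝ) ^ 2 * ((k : ℝ) ^ 2 * (∫ t in (0 : ℝ)..1, p.eval t ^ 2) - p.eval 0 ^ 2) := by
    linarith
  linarith [nonneg_of_mul_nonneg_right this hk']

end Interval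

/-! ### Restrictions of polynomials to lines -/

section Lines

/-- The restriction of `f` to each line is a polynomial of degree less than `k`. -/
def LineDegreeLT (k : ℕ) (f : Plane → ℝ) : Prop :=
  ∀ a b : Plane, ∃ q : Polynomial ℝ, q.degree < k ∧ ∀ t : ℝ, f (a + t • b) = q.eval t

theorem LineDegreeLT.add {k : ℕ} {f g : Plane → ℝ} (hf : LineDegreeLT k f)
    (hg : LineDegreeLT k g) : LineDegreeLT k fun x => f x + g x := fun a b => by
  obtain ⟨p, hp, hp'⟩ := hf a b
  obtain ⟨q, hq, hq'⟩ := hg a b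
  exact ⟨p + q, (Polynomial.degree_add_le _ _).trans_lt (max_lt hp hq), fun t => by simp [hp', hq']⟩

theorem LineDegreeLT.mul_const {k : ℕ} {f : Plane → ℝ} (hf : LineDegreeLT k f) (c : ℝ) :
    LineDegreeLT k fun x => f x * c := fun a b => by
  obtain ⟨p, hp, hp'⟩ := hf a b
  refine ⟨c • p, (Polynomial.degree_smul_le _ _).trans_lt hp, fun t => by simp [hp', mul_comm]⟩

theorem continuous_pval (p : MvPolynomial (Fin 2) ℝ) : Continuous (pval p) :=
  (MvPolynomial.continuous_eval p).comp (by fun_prop)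

theorem continuous_pgrad (p : MvPolynomial (Fin 2) ℝ) : Continuous (pgrad p) :=
  (PiLp.continuous_toLp 2 _).comp (continuous_pi fun _ => continuous_pval _)

theorem continuous_tderiv (o : Plane × Plane) (p : MvPolynomial (Fin 2) ℝ) :
    Continuous (tderiv o p) :=
  (continuous_pgrad p).inner continuous_const

theorem lineDegreeLT_pval_pderiv {k : ℕ} {p : MvPolynomial (Fin 2) ℝ} (hp : p.totalDegree ≤ k)
    (i : Fin 2) : LineDegreeLT k (pval (MvPolynomial.pderiv i p)) := fun a b => by
  let l : Fin 2 → Polynomial ℝ := fun j =>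
    Polynomial.C (a j) + Polynomial.X * Polynomial.C (b j)
  have hl : ∀ j, (l j).natDegree ≤ 1 := fun j => by
    refine (Polynomial.natDegree_add_le _ _).trans (max_le ?_ ?_)
    · exact (Polynomial.natDegree_C _).le.trans zero_le_one
    · exact (Polynomial.natDegree_mul_C_le _ _).trans Polynomial.natDegree_X_le
  refine ⟨MvPolynomial.aeval l (MvPolynomial.pderiv i p), ?_, fun t => ?_⟩
  · conv_lhs => rw [p.as_sum]
    rw [map_sum, map_sum]
    refine Polynomial.mem_degreeLT.1 (Submodule.sum_mem _ fun s hs => ?_)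
    rw [Polynomial.mem_degreeLT, MvPolynomial.pderiv_monomial]
    rcases Nat.eq_zero_or_pos (s i) with h0 | h0
    · simp [h0]
    · have hs' : (s.sum fun _ e => e) ≤ k := (MvPolynomial.le_totalDegree hs).trans hp
      have hsum : (s - Finsupp.single i 1).sum (fun _ e => e) + 1 = s.sum fun _ e => e := by
        have h1 : s - Finsupp.single i 1 + Finsupp.single i 1 = s :=
          tsub_add_cancel_of_le (Finsupp.single_le_iff.2 h0)
        conv_rhs => rw [← h1]
        rw [Finsupp.sum_add_index' (fun _ => rfl) (fun _ _ _ => rfl)]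
        simp
      have hd : (MvPolynomial.monomial (s - Finsupp.single i 1)
          (MvPolynomial.coeff s p * (s i : ℝ))).totalDegree ≤ k - 1 := by
        refine (MvPolynomial.totalDegree_monomial_le _ _).trans ?_
        change ((s - Finsupp.single i 1).sum fun _ e => e) ≤ k - 1
        omega
      have hd' := MvPolynomial.aeval_natDegree_le _ hd l hl
      refine (Polynomial.degree_le_natDegree.trans (Nat.cast_le.2 hd')).trans_lt ?_
      exact Nat.cast_lt.2 (by omega)
  · rw [pval, MvPolynomial.aeval_def, ← Polynomial.coe_evalRingHom, MvPolynomial.hom_eval₂]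
    rw [MvPolynomial.eval, MvPolynomial.coe_eval₂Hom]
    congr 1
    · ext x; simp
    · ext j; simp [l]; ring

theorem tderiv_eq (o : Plane × Plane) (p : MvPolynomial (Fin 2) ℝ) (x : Plane) :
    tderiv o p x = pval (MvPolynomial.pderiv 0 p) x * tangent o 0
      + pval (MvPolynomial.pderiv 1 p) x * tangent o 1 := by
  simp [tderiv, pgrad, PiLp.inner_apply, mul_comm]

theorem lineDegreeLT_tderiv {k : ℕ} {p : MvPolynomial (Fin 2) ℝ} (hp : p.totalDegree ≤ k)
    (o : Plane × Plane) : LineDegreeLT k (tderiv o p) := by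
  have := ((lineDegreeLT_pval_pderiv hp 0).mul_const (tangent o 0)).add
    ((lineDegreeLT_pval_pderiv hp 1).mul_const (tangent o 1))
  simpa only [← tderiv_eq] using this

theorem LineDegreeLT.sq_le {k : ℕ} {f : Plane → ℝ} (hf : LineDegreeLT k f) (a b : Plane) :
    f a ^ 2 ≤ (k : ℝ) ^ 2 * ∫ t in (0 : ℝ)..1, f (a + t • b) ^ 2 := by
  obtain ⟨q, hq, h⟩ := hf a b
  have h0 := h 0
  rw [zero_smul, add_zero] at h0
  simpa only [h, h0] using sq_eval_zero_le k q hq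

theorem LineDegreeLT.sq_le_half {k : ℕ} {f : Plane → ℝ} (hf : LineDegreeLT k f) (a b : Plane) :
    f a ^ 2 ≤ 2 * (k : ℝ) ^ 2 * ∫ t in (0 : ℝ)..(1 / 2), f (a + t • b) ^ 2 := by
  have h := hf.sq_le a ((1 / 2 : ℝ) • b)
  have e := intervalIntegral.integral_comp_mul_right (a := 0) (b := 1)
    (fun t => f (a + t • b) ^ 2) (c := (1 / 2 : ℝ)) (by norm_num)
  simp only [smul_smul, e] at h
  simp only [zero_mul, one_mul, smul_eq_mul] at h
  refine h.trans (le_of_eq ?_)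
  ring

end Lines

/-! ### Integrals along edges -/

section Edges

theorem hull_pair (A B : Plane) :
    (convexHull ℝ ({A, B} : Set Plane)) = (fun t : ℝ => A + t • (B - A)) '' Set.Icc 0 1 := by
  rw [convexHull_pair, segment_eq_image']

theorem edgeLength_pair [DecidableEq Plane] (A B : Plane) :
    edgeLength ({A, B} : Finset Plane) = dist A B := by
  rw [edgeLength]; push_cast; exact Metric.diam_pair

/-- The parametrization of the line through `A` and `B` by arc length. -/
theorem isometry_line {A B : Plane} (h : A ≠ B) :
    Isometry fun t : ℝ => A + (t * (dist A B)⁻¹) • (B - A) := by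
  refine Isometry.of_dist_eq fun s t => ?_
  have hd : dist A B ≠ 0 := dist_ne_zero.2 h
  rw [dist_add_left, dist_eq_norm, ← sub_smul, ← sub_mul, norm_smul, ← dist_eq_norm B A,
    dist_comm B A, norm_mul, norm_inv, Real.norm_of_nonneg (dist_nonneg (x := A) (y := B)), mul_assoc,
    inv_mul_cancel₀ hd, mul_one, Real.dist_eq, Real.norm_eq_abs]

theorem hull_pair_eq_image_line {A B : Plane} (h : A ≠ B) : (convexHull ℝ ({A, B} : Set Plane)) =
    (fun t : ℝ => A + (t * (dist A B)⁻¹) • (B - A)) '' Set.Icc 0 (dist A B) := by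
  have hd : 0 < dist A B := dist_pos.2 h
  rw [hull_pair]
  ext x
  constructor
  · rintro ⟨t, ⟨h0, h1⟩, rfl⟩
    refine ⟨t * dist A B, ⟨by positivity, by nlinarith⟩, ?_⟩
    simp only [mul_assoc, mul_inv_cancel₀ hd.ne', mul_one]
  · rintro ⟨t, ⟨h0, h1⟩, rfl⟩
    exact ⟨t * (dist A B)⁻¹, ⟨by positivity, by rw [← div_eq_mul_inv]; exact (div_le_one hd).2 h1⟩, rfl⟩

theorem setIntegral_hausdorff_pair {A B : Plane} (h : A ≠ B) (f : Plane → ℝ) :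
    ∫ x in convexHull ℝ ({A, B} : Set Plane), f x ∂(Measure.hausdorffMeasure 1 : Measure Plane)
      = dist A B * ∫ t in (0 : ℝ)..1, f (A + t • (B - A)) := by
  set g : ℝ → Plane := fun t => A + (t * (dist A B)⁻¹) • (B - A)
  have hg : Isometry g := isometry_line h
  have hd : 0 < dist A B := dist_pos.2 h
  have hm : Measure.map g volume = (Measure.hausdorffMeasure 1).restrict (Set.range g) := by
    rw [← hausdorffMeasure_real]; exact hg.map_hausdorffMeasure (Or.inl zero_le_one)
  have hs : convexHull ℝ ({A, B} : Set Plane) = g '' Set.Icc 0 (dist A B) :=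
    hull_pair_eq_image_line h
  have hcl : MeasurableSet (g '' Set.Icc 0 (dist A B)) :=
    (isCompact_Icc.image hg.continuous).measurableSet
  have e := hg.isClosedEmbedding.measurableEmbedding.setIntegral_map (μ := volume) f
    (g '' Set.Icc 0 (dist A B))
  rw [hm, Measure.restrict_restrict hcl, Set.inter_eq_left.2 (Set.image_subset_range _ _),
    hg.injective.preimage_image, integral_Icc_eq_integral_Ioc,
    ← intervalIntegral.integral_of_le hd.le] at e
  rw [hs, e]
  have := intervalIntegral.integral_comp_mul_right (a := 0) (b := dist A B)
    (fun t => f (A + t • (B - A))) (c := (dist A B)⁻¹) (inv_ne_zero hd.ne')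
  simp only [g]
  rw [this]
  simp [hd.ne']

theorem hausdorff_pair_lt_top {A B : Plane} (h : A ≠ B) :
    (Measure.hausdorffMeasure 1 : Measure Plane) (convexHull ℝ ({A, B} : Set Plane)) < ⊤ := by
  rw [hull_pair_eq_image_line h, (isometry_line h).hausdorffMeasure_image (Or.inl zero_le_one),
    hausdorffMeasure_real]
  simp

theorem isCompact_hull (s : Finset Plane) : IsCompact (hull s) :=
  s.finite_toSet.isCompact_convexHull ℝ

variable {e : Finset Plane}

theorem hausdorff_hull_lt_top (he : e.card = 2) :
    (Measure.hausdorffMeasure 1 : Measure Plane) (hull e) < ⊤ := by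
  classical
  obtain ⟨A, B, h, rfl⟩ := Finset.card_eq_two.1 he
  have := hausdorff_pair_lt_top h
  simpa [hull] using this

theorem edgeLength_pos (he : e.card = 2) : 0 < edgeLength e := by
  classical
  obtain ⟨A, B, h, rfl⟩ := Finset.card_eq_two.1 he
  rw [edgeLength_pair]; exact dist_pos.2 h

theorem edgeIntegral_pair [DecidableEq Plane] {A B : Plane} (h : A ≠ B) (f : Plane → ℝ) :
    edgeIntegral {A, B} f = dist A B * ∫ t in (0 : ℝ)..1, f (A + t • (B - A)) := by
  rw [← setIntegral_hausdorff_pair h, edgeIntegral, hull]; push_cast; rfl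

theorem integrableOn_edge_of_bounded (he : e.card = 2) {w f : Plane → ℝ} (hw : Measurable w)
    {C : ℝ} (hC : ∀ x ∈ hull e, |w x| ≤ C) (hf : Continuous f) :
    IntegrableOn (fun x => w x * f x) (hull e) (Measure.hausdorffMeasure 1) := by
  have hms := (isCompact_hull e).measurableSet
  obtain ⟨D, hD⟩ := (isCompact_hull e).exists_bound_of_continuousOn hf.continuousOn
  refine Measure.integrableOn_of_bounded (M := C * D) (hausdorff_hull_lt_top he).ne
    (hw.mul hf.measurable).aestronglyMeasurable ?_
  refine (ae_restrict_iff' hms).2 (Filter.Eventually.of_forall fun x hx => ?_)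
  rw [norm_mul]
  exact mul_le_mul (hC x hx) (hD x hx) (norm_nonneg _) ((abs_nonneg _).trans (hC x hx))

theorem integrableOn_edge (he : e.card = 2) {f : Plane → ℝ} (hf : Continuous f) :
    IntegrableOn f (hull e) (Measure.hausdorffMeasure 1) := by
  simpa using integrableOn_edge_of_bounded he (w := fun _ => 1) measurable_const (C := 1)
    (by simp) hf

theorem sq_endpoint_le [DecidableEq Plane] {k : ℕ} {f : Plane → ℝ} (hf : LineDegreeLT k f)
    {A B : Plane} (h : A ≠ B) {P : Plane} (hP : P = A ∨ P = B) :
    f P ^ 2 ≤ (k : ℝ) ^ 2 / edgeLength {A, B} * edgeIntegral {A, B} fun x => f x ^ 2 := by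
  have key : ∀ A B : Plane, A ≠ B →
      f A ^ 2 ≤ (k : ℝ) ^ 2 / edgeLength {A, B} * edgeIntegral {A, B} fun x => f x ^ 2 := by
    intro A B h
    have := dist_pos.2 h
    rw [edgeIntegral_pair h, edgeLength_pair]
    refine (hf.sq_le A (B - A)).trans (le_of_eq ?_)
    field_simp
  rcases hP with rfl | rfl
  · exact key _ _ h
  · rw [Finset.pair_comm]; exact key _ _ h.symm

end Edges

/-! ### The inverse trace inequality on a triangle -/

section Trace

open Set

/-- The square `[0, a]²`. -/
def square (a : ℝ) : Set Plane := {x | ∀ i, x i ∈ Icc 0 a}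

/-- The linear map that sends the standard basis to `U`, `V`. -/
noncomputable def basisMap (U V : Plane) : Plane →L[ℝ] Plane :=
  (EuclideanSpace.proj 0 : Plane →L[ℝ] ℝ).smulRight U +
    (EuclideanSpace.proj 1 : Plane →L[ℝ] ℝ).smulRight V

theorem basisMap_apply (U V x : Plane) : basisMap U V x = x 0 • U + x 1 • V := by
  simp [basisMap]

theorem preimage_square (a : ℝ) :
    (WithLp.toLp 2 : (Fin 2 → ℝ) → Plane) ⁻¹' square a = Icc (fun _ => 0) fun _ => a := by
  ext x; simp [square, Pi.le_def, forall_and]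

theorem measurableSet_square (a : ℝ) : MeasurableSet (square a) := by
  have : square a = ⋂ i, (fun x : Plane => x i) ⁻¹' Icc 0 a := by ext; simp [square]
  rw [this]
  exact (isClosed_iInter fun i => isClosed_Icc.preimage (by fun_prop)).measurableSet

theorem volume_square_one : volume (square 1) = 1 := by
  rw [← (PiLp.volume_preserving_toLp (Fin 2)).measure_preimage
    (measurableSet_square 1).nullMeasurableSet, preimage_square, Real.volume_Icc_pi]
  simp

theorem setIntegral_square {a : ℝ} (ha : 0 ≤ a) {g : Plane → ℝ} (hg : Continuous g) :
    ∫ x in square a, g x = ∫ s in (0 : ℝ)..a, ∫ t in (0 : ℝ)..a, g (!₂[s, t]) := by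
  have hT := PiLp.volume_preserving_toLp (Fin 2)
  rw [← hT.setIntegral_preimage_emb (MeasurableEquiv.toLp 2 (Fin 2 → ℝ)).measurableEmbedding,
    preimage_square]
  have h2 := (volume_preserving_finTwoArrow ℝ).symm
  rw [← h2.setIntegral_preimage_emb (MeasurableEquiv.finTwoArrow).symm.measurableEmbedding]
  have : (MeasurableEquiv.finTwoArrow : (Fin 2 → ℝ) ≃ᵐ ℝ × ℝ).symm ⁻¹'
      (Icc (fun _ => 0) fun _ => a) = Icc 0 a ×ˢ Icc 0 a := by
    ext x
    simp [MeasurableEquiv.finTwoArrow, Pi.le_def, Fin.forall_fin_two, Prod.le_def]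
  rw [this, Measure.volume_eq_prod, setIntegral_prod, integral_Icc_eq_integral_Ioc,
    ← intervalIntegral.integral_of_le ha]
  · refine intervalIntegral.integral_congr fun s _ => ?_
    rw [integral_Icc_eq_integral_Ioc, ← intervalIntegral.integral_of_le ha]
    rfl
  · refine ContinuousOn.integrableOn_compact (isCompact_Icc.prod isCompact_Icc) ?_
    refine Continuous.continuousOn (hg.comp ((PiLp.continuous_toLp 2 _).comp ?_))
    refine continuous_pi fun i => ?_
    fin_cases i
    · exact continuous_fst
    · exact continuous_snd

theorem hull_triple [DecidableEq Plane] (A B C : Plane) :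
    hull {A, B, C} = convexHull ℝ ({A, B, C} : Set Plane) := by
  rw [hull]; push_cast; rfl

variable {A B C : Plane}

theorem hull_triple_subset [DecidableEq Plane] :
    hull {A, B, C} ⊆ (fun x => A + basisMap (B - A) (C - A) x) '' square 1 := by
  rw [hull_triple]
  have hconv : Convex ℝ ((fun x => A + basisMap (B - A) (C - A) x) '' square 1) := by
    have h1 : Convex ℝ (square 1) := by
      have : square 1 = ⋂ i, (EuclideanSpace.proj i : Plane →L[ℝ] ℝ) ⁻¹' Icc 0 1 := by
        ext; simp [square]
      rw [this]
      exact convex_iInter fun i => (convex_Icc 0 1).is_linear_preimage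
        (EuclideanSpace.proj i : Plane →L[ℝ] ℝ).isBoundedLinearMap.toIsLinearMap
    have h2 := (h1.is_linear_image (basisMap (B - A) (C - A)).isBoundedLinearMap.toIsLinearMap).vadd A
    rwa [← Set.image_vadd, Set.image_image] at h2
  refine convexHull_min ?_ hconv
  rintro x (rfl | rfl | rfl)
  · refine ⟨!₂[0, 0], fun i => by fin_cases i <;> simp, by simp [basisMap_apply]⟩
  · refine ⟨!₂[1, 0], fun i => by fin_cases i <;> simp, by simp [basisMap_apply]⟩
  · refine ⟨!₂[0, 1], fun i => by fin_cases i <;> simp, by simp [basisMap_apply]⟩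

theorem image_square_half_subset [DecidableEq Plane] :
    (fun x => A + basisMap (B - A) (C - A) x) '' square (1 / 2) ⊆ hull {A, B, C} := by
  rw [hull_triple]
  rintro _ ⟨x, hx, rfl⟩
  have h0 := hx 0
  have h1 := hx 1
  have hA : A ∈ convexHull ℝ ({A, B, C} : Set Plane) := subset_convexHull _ _ (by simp)
  have hB : B ∈ convexHull ℝ ({A, B, C} : Set Plane) := subset_convexHull _ _ (by simp)
  have hC : C ∈ convexHull ℝ ({A, B, C} : Set Plane) := subset_convexHull _ _ (by simp)
  have := (convex_convexHull ℝ ({A, B, C} : Set Plane)).sum_mem (t := Finset.univ)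
    (w := ![1 - x 0 - x 1, x 0, x 1]) (z := ![A, B, C])
    (by
      intro i _
      fin_cases i
      · simp; linarith [h0.2, h1.2]
      · simpa using h0.1
      · simpa using h1.1)
    (by simp only [Fin.sum_univ_three, Matrix.cons_val]; ring)
    (by intro i _; fin_cases i <;> simpa)
  convert this using 1
  simp only [basisMap_apply, Fin.sum_univ_three]
  simp only [Matrix.cons_val]
  module

theorem pi_mul_sq_le_abs_det [DecidableEq Plane] {x : Plane} {r : ℝ} (hr : 0 < r)
    (h : Metric.closedBall x r ⊆ hull {A, B, C}) :
    Real.pi * r ^ 2 ≤ |(basisMap (B - A) (C - A)).det| := by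
  have h1 : volume (Metric.closedBall x r) ≤
      volume ((fun x => A + basisMap (B - A) (C - A) x) '' square 1) :=
    measure_mono (h.trans hull_triple_subset)
  have h2 : (fun x => A + basisMap (B - A) (C - A) x) '' square 1 =
      (fun y => A + y) '' (basisMap (B - A) (C - A) '' square 1) := (image_image _ _ _).symm
  rw [h2, image_add_left, measure_preimage_add, Measure.addHaar_image_continuousLinearMap,
    volume_square_one, mul_one, EuclideanSpace.volume_closedBall_fin_two] at h1
  have h3 := ENNReal.toReal_mono ENNReal.ofReal_ne_top h1
  rw [ENNReal.toReal_ofReal (abs_nonneg _), ENNReal.toReal_mul, ENNReal.toReal_pow,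
    ENNReal.toReal_ofReal hr.le] at h3
  rw [ENNReal.toReal_ofReal Real.pi_pos.le] at h3
  rw [mul_comm]
  exact h3

theorem half_trace_le [DecidableEq Plane] {k : ℕ} {f : Plane → ℝ} (hf : LineDegreeLT k f)
    (hfc : Continuous f) {x : Plane} {r : ℝ} (hr : 0 < r)
    (h : Metric.closedBall x r ⊆ hull {A, B, C}) :
    Real.pi * r ^ 2 * ∫ s in (0 : ℝ)..(1 / 2), f (A + s • (B - A)) ^ 2 ≤
      2 * (k : ℝ) ^ 2 * ∫ x in hull {A, B, C}, f x ^ 2 := by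
  set L := basisMap (B - A) (C - A)
  have hdet := pi_mul_sq_le_abs_det hr h
  have hdet0 : L.det ≠ 0 := abs_pos.1 (lt_of_lt_of_le (by positivity) hdet)
  have hinj : Function.Injective fun x => A + L x := by
    have : Function.Injective L :=
      (LinearEquiv.ofIsUnitDet (f := (L : Plane →ₗ[ℝ] Plane)) (v := Module.finBasis ℝ Plane)
        (v' := Module.finBasis ℝ Plane) (by
          rw [LinearMap.det_toMatrix]; exact isUnit_iff_ne_zero.2 hdet0)).injective
    exact fun a b hab => this (add_left_cancel hab)
  have hcov := integral_image_eq_integral_abs_det_fderiv_smul volume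
    (measurableSet_square (1 / 2)) (f := fun x => A + L x) (f' := fun _ => L)
    (fun x _ => (L.hasFDerivAt.const_add A).hasFDerivWithinAt) hinj.injOn (fun x => f x ^ 2)
  simp only [smul_eq_mul] at hcov
  have hsub : ∫ x in (fun x => A + L x) '' square (1 / 2), f x ^ 2
      ≤ ∫ x in hull {A, B, C}, f x ^ 2 := by
    refine setIntegral_mono_set ?_ (Filter.Eventually.of_forall fun x => sq_nonneg _)
      (Filter.Eventually.of_forall image_square_half_subset)
    exact (hfc.pow 2).continuousOn.integrableOn_compact (isCompact_hull _)
  have hcL : Continuous fun x => f (A + L x) ^ 2 :=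
    (hfc.comp (continuous_const.add L.continuous)).pow 2
  rw [hcov, integral_const_mul, setIntegral_square (by norm_num) hcL] at hsub
  have hc2 : Continuous fun p : ℝ × ℝ => f (A + p.1 • (B - A) + p.2 • (C - A)) ^ 2 :=
    (hfc.comp (by fun_prop)).pow 2
  have hline : ∫ s in (0 : ℝ)..(1 / 2), f (A + s • (B - A)) ^ 2 ≤
      2 * (k : ℝ) ^ 2 * ∫ s in (0 : ℝ)..(1 / 2), ∫ t in (0 : ℝ)..(1 / 2),
        f (A + L (!₂[s, t])) ^ 2 := by
    rw [← intervalIntegral.integral_const_mul]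
    refine intervalIntegral.integral_mono_on (by norm_num) ?_ ?_ fun s _ => ?_
    · exact ((hfc.comp (by fun_prop)).pow 2).intervalIntegrable _ _
    · refine Continuous.intervalIntegrable (continuous_const.mul ?_) _ _
      have : ∀ s t : ℝ, f (A + L (!₂[s, t])) ^ 2 = f (A + s • (B - A) + t • (C - A)) ^ 2 :=
        fun s t => by simp [L, basisMap_apply, add_assoc]
      simp only [this]
      exact intervalIntegral.continuous_parametric_intervalIntegral_of_continuous' hc2 0 (1 / 2)
    · have := hf.sq_le_half (A + s • (B - A)) (C - A)
      simpa [L, basisMap_apply, add_assoc] using this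
  have hnn : 0 ≤ ∫ s in (0 : ℝ)..(1 / 2), f (A + s • (B - A)) ^ 2 :=
    intervalIntegral.integral_nonneg (by norm_num) fun _ _ => sq_nonneg _
  calc _ ≤ |L.det| * ∫ s in (0 : ℝ)..(1 / 2), f (A + s • (B - A)) ^ 2 :=
        mul_le_mul_of_nonneg_right hdet hnn
    _ ≤ |L.det| * (2 * (k : ℝ) ^ 2 * ∫ s in (0 : ℝ)..(1 / 2), ∫ t in (0 : ℝ)..(1 / 2),
        f (A + L (!₂[s, t])) ^ 2) := mul_le_mul_of_nonneg_left hline (abs_nonneg _)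
    _ = 2 * (k : ℝ) ^ 2 * (|L.det| * ∫ s in (0 : ℝ)..(1 / 2), ∫ t in (0 : ℝ)..(1 / 2),
        f (A + L (!₂[s, t])) ^ 2) := by ring
    _ ≤ _ := mul_le_mul_of_nonneg_left hsub (by positivity)

/-- The inverse trace inequality on a triangle, with the sharp dependence on the degree. -/
theorem edge_trace_le {T e : Finset Plane} (hT : T.card = 3) (he : e.card = 2) (heT : e ⊆ T)
    {k : ℕ} {f : Plane → ℝ} (hf : LineDegreeLT k f) (hfc : Continuous f) {ϱ : ℝ}
    {x : Plane} {r : ℝ} (hr : 0 < r) (h : Metric.closedBall x r ⊆ hull T)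
    (hdiam : Metric.diam (hull T) ≤ ϱ * r) :
    edgeLength e * (edgeIntegral e fun x => f x ^ 2) ≤
      2 * ϱ ^ 2 * (k : ℝ) ^ 2 * ∫ x in hull T, f x ^ 2 := by
  classical
  obtain ⟨A, B, hAB, rfl⟩ := Finset.card_eq_two.1 he
  obtain ⟨C, hC⟩ : ∃ C, T \ {A, B} = {C} := Finset.card_eq_one.1 (by
    rw [Finset.card_sdiff_of_subset heT, hT, he])
  have hTe : T = {A, B, C} := by
    rw [← Finset.sdiff_union_of_subset heT, hC]; ext; simp; tauto
  subst hTe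
  have hTe' : ({B, A, C} : Finset Plane) = {A, B, C} := by ext; simp; tauto
  have h1 := half_trace_le (A := A) (B := B) (C := C) hf hfc hr h
  have h2 := half_trace_le (A := B) (B := A) (C := C) hf hfc hr (by rwa [hTe'])
  rw [hTe'] at h2
  have hlen : dist A B ≤ ϱ * r := by
    refine le_trans (Metric.dist_le_diam_of_mem (isCompact_hull _).isBounded ?_ ?_) hdiam <;>
    exact subset_convexHull _ _ (by simp)
  have hsplit : ∫ t in (0 : ℝ)..1, f (A + t • (B - A)) ^ 2
      = (∫ s in (0 : ℝ)..(1 / 2), f (A + s • (B - A)) ^ 2)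
        + ∫ s in (0 : ℝ)..(1 / 2), f (B + s • (A - B)) ^ 2 := by
    have hc : Continuous fun t : ℝ => f (A + t • (B - A)) ^ 2 := (hfc.comp (by fun_prop)).pow 2
    rw [← intervalIntegral.integral_add_adjacent_intervals (hc.intervalIntegrable 0 (1 / 2))
      (hc.intervalIntegrable (1 / 2) 1)]
    congr 1
    have := intervalIntegral.integral_comp_sub_left (a := 0) (b := 1 / 2)
      (fun t => f (A + t • (B - A)) ^ 2) (1 : ℝ)
    norm_num at this ⊢
    rw [← this]
    congr 1
    ext t
    congr 2
    module
  rw [edgeIntegral_pair hAB, edgeLength_pair, hsplit]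
  set I := ∫ x in hull {A, B, C}, f x ^ 2
  set J := (∫ s in (0 : ℝ)..(1 / 2), f (A + s • (B - A)) ^ 2)
        + ∫ s in (0 : ℝ)..(1 / 2), f (B + s • (A - B)) ^ 2
  have hJ : 0 ≤ J := add_nonneg
    (intervalIntegral.integral_nonneg (by norm_num) fun _ _ => sq_nonneg _)
    (intervalIntegral.integral_nonneg (by norm_num) fun _ _ => sq_nonneg _)
  have hsum : Real.pi * r ^ 2 * J ≤ 4 * (k : ℝ) ^ 2 * I := by
    simp only [J, mul_add]; linarith
  have hpi : 2 * (r ^ 2 * J) ≤ Real.pi * (r ^ 2 * J) :=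
    mul_le_mul_of_nonneg_right Real.two_le_pi (by positivity)
  have hd2 : dist A B ^ 2 ≤ ϱ ^ 2 * r ^ 2 := by
    rw [← mul_pow]; exact pow_le_pow_left₀ dist_nonneg hlen 2
  have h3 : dist A B ^ 2 * J ≤ ϱ ^ 2 * r ^ 2 * J := mul_le_mul_of_nonneg_right hd2 hJ
  have h4 : ϱ ^ 2 * (r ^ 2 * J) ≤ ϱ ^ 2 * (2 * (k : ℝ) ^ 2 * I) :=
    mul_le_mul_of_nonneg_left (by linarith) (sq_nonneg _)
  linarith

theorem norm_pgrad_sq (p : MvPolynomial (Fin 2) ℝ) (x : Plane) : ‖pgrad p x‖ ^ 2 =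
    pval (MvPolynomial.pderiv 0 p) x ^ 2 + pval (MvPolynomial.pderiv 1 p) x ^ 2 := by
  rw [EuclideanSpace.norm_sq_eq]; simp [pgrad]

theorem edge_trace_pgrad_le {T e : Finset Plane} (hT : T.card = 3) (he : e.card = 2) (heT : e ⊆ T)
    {k : ℕ} {p : MvPolynomial (Fin 2) ℝ} (hp : p.totalDegree ≤ k) {ϱ : ℝ}
    {x : Plane} {r : ℝ} (hr : 0 < r) (h : Metric.closedBall x r ⊆ hull T)
    (hdiam : Metric.diam (hull T) ≤ ϱ * r) :
    edgeLength e * (edgeIntegral e fun x => ‖pgrad p x‖ ^ 2) ≤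
      2 * ϱ ^ 2 * (k : ℝ) ^ 2 * ∫ x in hull T, ‖pgrad p x‖ ^ 2 := by
  have hc : ∀ i, Continuous fun x => pval (MvPolynomial.pderiv i p) x ^ 2 :=
    fun i => (continuous_pval _).pow 2
  have key := fun i => edge_trace_le hT he heT (lineDegreeLT_pval_pderiv hp i)
    (continuous_pval _) hr h hdiam
  have hcT : ∀ i, IntegrableOn (fun x => pval (MvPolynomial.pderiv i p) x ^ 2) (hull T) :=
    fun i => (hc i).continuousOn.integrableOn_compact (isCompact_hull _)
  simp only [edgeIntegral, norm_pgrad_sq] at key ⊢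
  rw [integral_add (integrableOn_edge he (hc 0)) (integrableOn_edge he (hc 1)),
    integral_add (hcT 0) (hcT 1)]
  linarith [key 0, key 1]

end Trace

/-! ### Cauchy–Schwarz inequalities in squared form -/

section CauchySchwarz

theorem two_mul_abs_le_of_sq_le {b X Y ε : ℝ} (hX : 0 ≤ X) (hY : 0 ≤ Y) (h : b ^ 2 ≤ X * Y)
    (hε : 0 < ε) : 2 * |b| ≤ ε * X + ε⁻¹ * Y := by
  have h1 : ε * X * (ε⁻¹ * Y) = X * Y := by field_simp
  have h2 : 0 ≤ ε * X + ε⁻¹ * Y := by positivity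
  rw [← abs_two, ← abs_mul]
  refine abs_le_of_sq_le_sq ?_ h2
  nlinarith [sq_nonneg (ε * X - ε⁻¹ * Y)]

theorem sq_le_of_two_mul_abs_le {b X Y : ℝ} (hX : 0 ≤ X) (hY : 0 ≤ Y)
    (h : ∀ ε : ℝ, 0 < ε → 2 * |b| ≤ ε * X + ε⁻¹ * Y) : b ^ 2 ≤ X * Y := by
  have := discrim_le_zero (a := X) (b := -(2 * |b|)) (c := Y) fun x => by
    rcases lt_or_ge 0 x with hx | hx
    · have h1 := mul_le_mul_of_nonneg_left (h x hx) hx.le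
      have h2 : x * (x * X + x⁻¹ * Y) = X * (x * x) + Y := by field_simp
      linarith
    · have := mul_nonneg hX (mul_self_nonneg x)
      have := mul_nonneg (neg_nonneg.2 hx) (abs_nonneg b)
      linarith
  rw [discrim, neg_sq, mul_pow, sq_abs] at this
  linarith

theorem sq_integral_le_mul {μ : Measure Plane} {F X Y : Plane → ℝ} (hX : Integrable X μ)
    (hY : Integrable Y μ) (hX0 : ∀ᵐ x ∂μ, 0 ≤ X x) (hY0 : ∀ᵐ x ∂μ, 0 ≤ Y x)
    (h : ∀ᵐ x ∂μ, F x ^ 2 ≤ X x * Y x) :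
    (∫ x, F x ∂μ) ^ 2 ≤ (∫ x, X x ∂μ) * ∫ x, Y x ∂μ := by
  refine sq_le_of_two_mul_abs_le (integral_nonneg_of_ae hX0) (integral_nonneg_of_ae hY0)
    fun ε hε => ?_
  have hI : Integrable (fun x => (ε * X x + ε⁻¹ * Y x) / 2) μ :=
    ((hX.const_mul ε).add (hY.const_mul ε⁻¹)).div_const 2
  have := norm_integral_le_of_norm_le (f := F) hI (by
    filter_upwards [hX0, hY0, h] with x h1 h2 h3
    have := two_mul_abs_le_of_sq_le h1 h2 h3 hε
    rw [Real.norm_eq_abs]; linarith)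
  rw [integral_div, integral_add (hX.const_mul ε) (hY.const_mul ε⁻¹), integral_const_mul,
    integral_const_mul, Real.norm_eq_abs] at this
  linarith

theorem sq_edgeIntegral_le_mul {e : Finset Plane} {F X Y : Plane → ℝ}
    (hX : IntegrableOn X (hull e) (Measure.hausdorffMeasure 1))
    (hY : IntegrableOn Y (hull e) (Measure.hausdorffMeasure 1))
    (hX0 : ∀ x ∈ hull e, 0 ≤ X x) (hY0 : ∀ x ∈ hull e, 0 ≤ Y x)
    (h : ∀ x ∈ hull e, F x ^ 2 ≤ X x * Y x) :
    edgeIntegral e F ^ 2 ≤ edgeIntegral e X * edgeIntegral e Y := by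
  have ae : ∀ {p : Plane → Prop}, (∀ x ∈ hull e, p x) →
      ∀ᵐ x ∂(Measure.hausdorffMeasure 1 : Measure Plane).restrict (hull e), p x := fun hp =>
    (ae_restrict_iff' (isCompact_hull e).measurableSet).2 (Filter.Eventually.of_forall hp)
  exact sq_integral_le_mul hX hY (ae hX0) (ae hY0) (ae h)

theorem edgeIntegral_nonneg {e : Finset Plane} {X : Plane → ℝ} (h : ∀ x ∈ hull e, 0 ≤ X x) :
    0 ≤ edgeIntegral e X :=
  setIntegral_nonneg (isCompact_hull e).measurableSet h

theorem edgeIntegral_mono {e : Finset Plane} {X Y : Plane → ℝ}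
    (hX : IntegrableOn X (hull e) (Measure.hausdorffMeasure 1))
    (hY : IntegrableOn Y (hull e) (Measure.hausdorffMeasure 1))
    (h : ∀ x ∈ hull e, X x ≤ Y x) : edgeIntegral e X ≤ edgeIntegral e Y :=
  setIntegral_mono_on hX hY (isCompact_hull e).measurableSet h

theorem edgeIntegral_const_mul (e : Finset Plane) (a : ℝ) (X : Plane → ℝ) :
    edgeIntegral e (fun x => a * X x) = a * edgeIntegral e X :=
  integral_const_mul a X

theorem add_sq_le_add_mul_add {a b X X' Y Y' : ℝ} (hX : 0 ≤ X) (hX' : 0 ≤ X') (hY : 0 ≤ Y)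
    (hY' : 0 ≤ Y') (ha : a ^ 2 ≤ X * Y) (hb : b ^ 2 ≤ X' * Y') :
    (a + b) ^ 2 ≤ (X + X') * (Y + Y') := by
  refine sq_le_of_two_mul_abs_le (by positivity) (by positivity) fun ε hε => ?_
  have h1 := two_mul_abs_le_of_sq_le hX hY ha hε
  have h2 := two_mul_abs_le_of_sq_le hX' hY' hb hε
  linarith [abs_add_le a b]

theorem sq_inner_le {E : Type*} [NormedAddCommGroup E] [InnerProductSpace ℝ E] (x y : E) :
    inner ℝ x y ^ 2 ≤ ‖x‖ ^ 2 * ‖y‖ ^ 2 := by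
  rw [← mul_pow, ← sq_abs]
  exact pow_le_pow_left₀ (abs_nonneg _) (abs_real_inner_le_norm x y) 2

end CauchySchwarz

/-! ### Bounds on the permeability -/

section Permeability

variable {M : Matrix (Fin 2) (Fin 2) ℝ} {θ Θ : ℝ}

theorem abs_entry_le (hθ : 0 < θ) (h1 : (M - θ • (1 : Matrix (Fin 2) (Fin 2) ℝ)).PosSemidef)
    (h2 : (Θ • (1 : Matrix (Fin 2) (Fin 2) ℝ) - M).PosSemidef) (i j : Fin 2) : |M i j| ≤ Θ := by
  have hs : M 1 0 = M 0 1 := by simpa using h1.isHermitian.apply 0 1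
  have a0 := h1.diag_nonneg (i := 0)
  have a1 := h1.diag_nonneg (i := 1)
  have b0 := h2.diag_nonneg (i := 0)
  have b1 := h2.diag_nonneg (i := 1)
  have p := h1.dotProduct_mulVec_nonneg ![1, 1]
  have q := h1.dotProduct_mulVec_nonneg ![1, -1]
  simp [Matrix.mulVec, dotProduct, Fin.sum_univ_two] at a0 a1 b0 b1 p q
  rw [abs_le]
  fin_cases i <;> fin_cases j <;> simp <;> constructor <;> linarith

theorem norm_mulVec_sq_le (hM : ∀ i j, |M i j| ≤ Θ) (w : Plane) :
    ‖(WithLp.toLp 2 (M.mulVec fun i => w i) : Plane)‖ ^ 2 ≤ 4 * Θ ^ 2 * ‖w‖ ^ 2 := by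
  have hsq : ∀ i j, M i j ^ 2 ≤ Θ ^ 2 := fun i j => by
    rw [← sq_abs]; exact pow_le_pow_left₀ (abs_nonneg _) (hM i j) 2
  have row : ∀ i, (M i 0 * w 0 + M i 1 * w 1) ^ 2 ≤ 2 * Θ ^ 2 * (w 0 ^ 2 + w 1 ^ 2) := fun i =>
    calc (M i 0 * w 0 + M i 1 * w 1) ^ 2
        ≤ (M i 0 ^ 2 + M i 1 ^ 2) * (w 0 ^ 2 + w 1 ^ 2) := by
          nlinarith [sq_nonneg (M i 0 * w 1 - M i 1 * w 0)]
      _ ≤ _ := mul_le_mul_of_nonneg_right (by linarith [hsq i 0, hsq i 1]) (by positivity)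
  rw [EuclideanSpace.norm_sq_eq, EuclideanSpace.norm_sq_eq]
  simp only [Fin.sum_univ_two, Matrix.mulVec, dotProduct, Real.norm_eq_abs, sq_abs]
  linarith [row 0, row 1]

theorem le_inner_mulVec (h1 : (M - θ • (1 : Matrix (Fin 2) (Fin 2) ℝ)).PosSemidef) (w : Plane) :
    θ * ‖w‖ ^ 2 ≤ inner ℝ (WithLp.toLp 2 (M.mulVec fun i => w i) : Plane) w := by
  have p := h1.dotProduct_mulVec_nonneg fun i => w i
  rw [EuclideanSpace.norm_sq_eq, PiLp.inner_apply]
  simp [Matrix.mulVec, dotProduct, Fin.sum_univ_two] at p ⊢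
  linarith

end Permeability

/-! ### The terms of the bilinear forms -/

theorem continuous_norm_pgrad_sq (p : MvPolynomial (Fin 2) ℝ) :
    Continuous fun x => ‖pgrad p x‖ ^ 2 :=
  (continuous_pgrad p).norm.pow 2

theorem continuous_tderiv_sq (o : Plane × Plane) (p : MvPolynomial (Fin 2) ℝ) :
    Continuous fun x => tderiv o p x ^ 2 :=
  (continuous_tderiv o p).pow 2

namespace FracturedMesh

variable {D : FracturedMesh} {c : Coefficients} {θ Θ ϱ σ α₀ α₀' : ℝ} {k : ℕ}
  {u v : Finset Plane → MvPolynomial (Fin 2) ℝ}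

open scoped Classical in
theorem card_eq_two_of_mem_edges {e : Finset Plane} (he : e ∈ D.mesh.edges) : e.card = 2 := by
  obtain ⟨T, _, h⟩ := Finset.mem_biUnion.1 he
  exact (Finset.mem_powersetCard.1 h).2

open scoped Classical in
theorem γ_edges_subset (γ : MeshCurve D.mesh) : γ.edges ⊆ D.mesh.edges := fun e he => by
  obtain ⟨o, ho, rfl⟩ := Finset.mem_image.1 he
  exact (Finset.mem_filter.1 (γ.isEdge o ho)).1

open scoped Classical in
theorem fluxEdges_subset : D.fluxEdges ⊆ D.mesh.edges := fun e he => by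
  rcases Finset.mem_union.1 he with he | he
  · rcases Finset.mem_union.1 he with he | he
    · exact (Finset.mem_filter.1 (Finset.mem_sdiff.1 he).1).1
    · exact (Finset.mem_filter.1 (Finset.mem_filter.1 he).1).1
  · exact γ_edges_subset _ he

open scoped Classical in
theorem card_edgeOf {γ : MeshCurve D.mesh} {o : Plane × Plane} (ho : o ∈ γ.dirEdges) :
    (edgeOf o).card = 2 :=
  card_eq_two_of_mem_edges (Finset.mem_filter.1 (γ.isEdge o ho)).1

theorem hull_subset_carrier {γ : MeshCurve D.mesh} {o : Plane × Plane} (ho : o ∈ γ.dirEdges) :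
    hull (edgeOf o) ⊆ γ.carrier :=
  Set.subset_biUnion_of_mem (u := fun o => hull (edgeOf o)) ho

theorem hull_subset_carrier_of_mem_edges {γ : MeshCurve D.mesh} {e : Finset Plane}
    (he : e ∈ γ.edges) : hull e ⊆ γ.carrier := by
  classical
  obtain ⟨o, ho, rfl⟩ := Finset.mem_image.1 he
  exact hull_subset_carrier ho

theorem mem_cellsAt {T e : Finset Plane} : T ∈ D.mesh.cellsAt e ↔ T ∈ D.mesh.cells ∧ e ⊆ T := by
  classical
  exact Finset.mem_filter

theorem continuous_jump (v : Finset Plane → MvPolynomial (Fin 2) ℝ) (e : Finset Plane) :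
    Continuous (D.jump v e) :=
  continuous_finsetSum _ fun _ _ => (continuous_pval _).smul continuous_const

theorem penalty_nonneg (hα : 0 < α₀) (e : Finset Plane) : 0 ≤ penalty α₀ k e :=
  div_nonneg (by positivity) Metric.diam_nonneg

theorem penaltyJoint_nonneg (hα : 0 < α₀') (p : (Plane × Plane) × (Plane × Plane)) :
    0 ≤ penaltyJoint α₀' k p :=
  div_nonneg (by positivity) (le_min Metric.diam_nonneg Metric.diam_nonneg)

theorem penaltyTip_nonneg (hα : 0 < α₀') (p : (Plane × Plane) × Plane) :
    0 ≤ penaltyTip α₀' k p :=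
  div_nonneg (by positivity) Metric.diam_nonneg

/-- The broken `H¹` seminorm, squared. -/
noncomputable def gradSq (D : FracturedMesh) (v : Finset Plane → MvPolynomial (Fin 2) ℝ) : ℝ :=
  ∑ T ∈ D.mesh.cells, ∫ x in hull T, ‖pgrad (v T) x‖ ^ 2

/-- The penalty part of the squared DG norm. -/
noncomputable def jumpSq (D : FracturedMesh) (α₀ : ℝ) (k : ℕ)
    (v : Finset Plane → MvPolynomial (Fin 2) ℝ) : ℝ :=
  ∑ e ∈ D.fluxEdges, edgeIntegral e fun x => penalty α₀ k e * ‖D.jump v e x‖ ^ 2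

/-- The barrier part of the squared DG norm. -/
noncomputable def barrierSq (D : FracturedMesh) (c : Coefficients)
    (v : Finset Plane → MvPolynomial (Fin 2) ℝ) : ℝ :=
  ∑ e ∈ D.γ₁.edges, edgeIntegral e fun x => c.kb x / c.a x * ‖D.jump v e x‖ ^ 2

/-- The flux term of the form `a_h`. -/
noncomputable def fluxTerm (D : FracturedMesh) (c : Coefficients)
    (u v : Finset Plane → MvPolynomial (Fin 2) ℝ) : ℝ :=
  ∑ e ∈ D.fluxEdges, edgeIntegral e fun x => inner ℝ (D.avgFlux c u e x) (D.jump v e x)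

theorem gradSq_nonneg : 0 ≤ D.gradSq v :=
  Finset.sum_nonneg fun _ _ => integral_nonneg fun _ => sq_nonneg _

theorem jumpSq_nonneg (hα : 0 < α₀) : 0 ≤ D.jumpSq α₀ k v :=
  Finset.sum_nonneg fun _ _ => edgeIntegral_nonneg fun _ _ =>
    mul_nonneg (penalty_nonneg hα _) (sq_nonneg _)

theorem kb_div_a_nonneg (hc : c.Admissible D θ Θ) {e : Finset Plane} (he : e ∈ D.γ₁.edges)
    {x : Plane} (hx : x ∈ hull e) : 0 ≤ c.kb x / c.a x := by
  have := hull_subset_carrier_of_mem_edges he hx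
  exact div_nonneg (hc.kb_nonneg x this) (hc.a_pos x (Or.inl this)).le

theorem barrierSq_nonneg (hc : c.Admissible D θ Θ) : 0 ≤ D.barrierSq c v :=
  Finset.sum_nonneg fun _ he => edgeIntegral_nonneg fun _ hx =>
    mul_nonneg (kb_div_a_nonneg hc he hx) (sq_nonneg _)

theorem tangentialSq_nonneg {cell : Plane × Plane → Finset Plane} : 0 ≤ D.tangentialSq cell v :=
  Finset.sum_nonneg fun _ _ => edgeIntegral_nonneg fun _ _ => sq_nonneg _

theorem vertexPenalty_nonneg (hα : 0 < α₀') {cell : Plane × Plane → Finset Plane} :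
    0 ≤ D.vertexPenalty α₀' k cell v v := by
  refine add_nonneg (Finset.sum_nonneg fun p _ => ?_) (Finset.sum_nonneg fun p _ => ?_)
  · rw [mul_assoc]; exact mul_nonneg (penaltyJoint_nonneg hα p) (mul_self_nonneg _)
  · rw [mul_assoc]; exact mul_nonneg (penaltyTip_nonneg hα p) (mul_self_nonneg _)

theorem flux_sq_le (hθ : 0 < θ) (hc : c.Admissible D θ Θ) {T : Finset Plane}
    (hT : T ∈ D.mesh.cells) {x : Plane} (hx : x ∈ hull T) :
    ‖flux c v T x‖ ^ 2 ≤ 4 * Θ ^ 2 * ‖pgrad (v T) x‖ ^ 2 :=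
  norm_mulVec_sq_le (abs_entry_le hθ (hc.K_lower T hT x hx) (hc.K_upper T hT x hx)) _

theorem integrableOn_hull {f : Plane → ℝ} (hf : Continuous f) (T : Finset Plane) :
    IntegrableOn f (hull T) :=
  hf.continuousOn.integrableOn_compact (isCompact_hull T)

theorem sq_bulkTerm_le (hθ : 0 < θ) (hc : c.Admissible D θ Θ) :
    (∑ T ∈ D.mesh.cells, ∫ x in hull T, inner ℝ (flux c u T x) (pgrad (v T) x)) ^ 2
      ≤ (4 * Θ ^ 2 * D.gradSq u) * D.gradSq v := by
  have hsum : 4 * Θ ^ 2 * D.gradSq u =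
      ∑ T ∈ D.mesh.cells, 4 * Θ ^ 2 * ∫ x in hull T, ‖pgrad (u T) x‖ ^ 2 := Finset.mul_sum ..
  rw [hsum]
  refine Finset.sum_sq_le_sum_mul_sum_of_sq_le_mul _
    (fun T _ => mul_nonneg (by positivity) (integral_nonneg fun _ => sq_nonneg _))
    (fun T _ => integral_nonneg fun _ => sq_nonneg _) fun T hT => ?_
  rw [← integral_const_mul (4 * Θ ^ 2)]
  refine sq_integral_le_mul (integrableOn_hull ((continuous_norm_pgrad_sq _).const_mul _) T)
    (integrableOn_hull (continuous_norm_pgrad_sq _) T)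
    (Filter.Eventually.of_forall fun _ => by positivity)
    (Filter.Eventually.of_forall fun _ => by positivity) ?_
  refine (ae_restrict_iff' (isCompact_hull T).measurableSet).2
    (Filter.Eventually.of_forall fun x hx => (sq_inner_le _ _).trans ?_)
  exact mul_le_mul_of_nonneg_right (flux_sq_le hθ hc hT hx) (sq_nonneg _)

theorem le_bulkTerm (hθ : 0 < θ) (hc : c.Admissible D θ Θ) :
    θ * D.gradSq u ≤
      ∑ T ∈ D.mesh.cells, ∫ x in hull T, inner ℝ (flux c u T x) (pgrad (u T) x) := by
  rw [gradSq, Finset.mul_sum]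
  refine Finset.sum_le_sum fun T hT => ?_
  rw [← integral_const_mul]
  have hms := (isCompact_hull T).measurableSet
  have hg := continuous_pgrad (u T)
  refine setIntegral_mono_on (integrableOn_hull ((continuous_norm_pgrad_sq _).const_mul _) T) ?_ hms
    fun x hx => le_inner_mulVec (hc.K_lower T hT x hx) _
  refine Integrable.mono' (g := fun x => (4 * Θ ^ 2 + 1) * ‖pgrad (u T) x‖ ^ 2)
    (integrableOn_hull ((continuous_norm_pgrad_sq _).const_mul _) T) ?_ ?_
  · have hfl : Measurable (flux c u T) := by
      refine (PiLp.continuous_toLp 2 _).measurable.comp (measurable_pi_lambda _ fun i => ?_)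
      simp only [Matrix.mulVec, dotProduct, Fin.sum_univ_two]
      have hgi : ∀ j, Measurable fun x => pgrad (u T) x j := fun j =>
        ((EuclideanSpace.proj j : Plane →L[ℝ] ℝ).continuous.comp hg).measurable
      exact ((hc.measurable_K T hT i 0).mul (hgi 0)).add ((hc.measurable_K T hT i 1).mul (hgi 1))
    exact (hfl.inner hg.measurable).aestronglyMeasurable
  · refine (ae_restrict_iff' hms).2 (Filter.Eventually.of_forall fun x hx => ?_)
    have h1 := flux_sq_le (v := u) hθ hc hT hx
    have h2 := norm_inner_le_norm (𝕜 := ℝ) (flux c u T x) (pgrad (u T) x)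
    nlinarith [sq_nonneg (‖flux c u T x‖ - ‖pgrad (u T) x‖), norm_nonneg (flux c u T x),
      norm_nonneg (pgrad (u T) x)]

theorem norm_avgFlux_sq_le (hθ : 0 < θ) (hc : c.Admissible D θ Θ) {e : Finset Plane} {x : Plane}
    (hx : x ∈ hull e) :
    ‖D.avgFlux c u e x‖ ^ 2 ≤ 4 * Θ ^ 2 * ∑ T ∈ D.mesh.cellsAt e, ‖pgrad (u T) x‖ ^ 2 := by
  set n : ℝ := ((D.mesh.cellsAt e).card : ℝ)
  have hn0 : 0 ≤ n := Nat.cast_nonneg _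
  have h1 : ‖∑ T ∈ D.mesh.cellsAt e, flux c u T x‖ ^ 2 ≤
      n * ∑ T ∈ D.mesh.cellsAt e, ‖flux c u T x‖ ^ 2 :=
    (pow_le_pow_left₀ (norm_nonneg _) (norm_sum_le _ _) 2).trans sq_sum_le_card_mul_sum_sq
  have h2 : ∑ T ∈ D.mesh.cellsAt e, ‖flux c u T x‖ ^ 2 ≤
      4 * Θ ^ 2 * ∑ T ∈ D.mesh.cellsAt e, ‖pgrad (u T) x‖ ^ 2 := by
    rw [Finset.mul_sum]
    refine Finset.sum_le_sum fun T hT => ?_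
    obtain ⟨hT, heT⟩ := mem_cellsAt.1 hT
    exact flux_sq_le hθ hc hT (convexHull_mono (Finset.coe_subset.2 heT) hx)
  have h3 : 0 ≤ ∑ T ∈ D.mesh.cellsAt e, ‖flux c u T x‖ ^ 2 :=
    Finset.sum_nonneg fun _ _ => sq_nonneg _
  have hn : n⁻¹ ^ 2 * n ≤ 1 := by
    rcases Nat.eq_zero_or_pos (D.mesh.cellsAt e).card with h | h
    · simp [n, h]
    · have : (1 : ℝ) ≤ n := Nat.one_le_cast.2 h
      have : n⁻¹ ^ 2 * n = n⁻¹ := by field_simp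
      rw [this]
      exact inv_le_one_of_one_le₀ ‹_›
  refine le_trans ?_ h2
  rw [avgFlux, norm_smul, mul_pow, Real.norm_of_nonneg (inv_nonneg.2 hn0)]
  calc n⁻¹ ^ 2 * ‖∑ T ∈ D.mesh.cellsAt e, flux c u T x‖ ^ 2
      ≤ n⁻¹ ^ 2 * (n * ∑ T ∈ D.mesh.cellsAt e, ‖flux c u T x‖ ^ 2) :=
        mul_le_mul_of_nonneg_left h1 (sq_nonneg _)
    _ = (n⁻¹ ^ 2 * n) * ∑ T ∈ D.mesh.cellsAt e, ‖flux c u T x‖ ^ 2 := by ring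
    _ ≤ 1 * _ := mul_le_mul_of_nonneg_right hn h3
    _ = _ := one_mul _

theorem sum_cellsAt_le :
    ∑ e ∈ D.fluxEdges, ∑ T ∈ D.mesh.cellsAt e, ∫ x in hull T, ‖pgrad (u T) x‖ ^ 2
      ≤ 3 * D.gradSq u := by
  classical
  have hnn : ∀ T : Finset Plane, 0 ≤ ∫ x in hull T, ‖pgrad (u T) x‖ ^ 2 :=
    fun T => integral_nonneg fun _ => sq_nonneg _
  rw [Finset.sum_comm' (t' := D.mesh.cells) (s' := fun T => D.fluxEdges.filter fun e => e ⊆ T)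
    (fun e T => by rw [mem_cellsAt, Finset.mem_filter]; tauto), gradSq, Finset.mul_sum]
  refine Finset.sum_le_sum fun T hT => ?_
  rw [Finset.sum_const, nsmul_eq_mul]
  refine mul_le_mul_of_nonneg_right ?_ (hnn T)
  have h : (D.fluxEdges.filter fun e => e ⊆ T) ⊆ T.powersetCard 2 := fun e he => by
    obtain ⟨h1, h2⟩ := Finset.mem_filter.1 he
    exact Finset.mem_powersetCard.2 ⟨h2, card_eq_two_of_mem_edges (fluxEdges_subset h1)⟩
  have := Finset.card_le_card h
  rw [Finset.card_powersetCard, D.mesh.card_eq T hT] at this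
  exact_mod_cast this

theorem sq_fluxTerm_le (hθ : 0 < θ) (hc : c.Admissible D θ Θ) (hρ : D.mesh.ShapeRegular ϱ)
    (hα : 0 < α₀) (hu : u ∈ D.mesh.DGSpace k) :
    D.fluxTerm c u v ^ 2 ≤ (24 * Θ ^ 2 * ϱ ^ 2 / α₀ * D.gradSq u) * D.jumpSq α₀ k v := by
  let g : Finset Plane → ℝ := fun e =>
    ∑ T ∈ D.mesh.cellsAt e, ∫ x in hull T, ‖pgrad (u T) x‖ ^ 2
  have hg : ∀ e, 0 ≤ g e := fun e =>
    Finset.sum_nonneg fun _ _ => integral_nonneg fun _ => sq_nonneg _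
  have hpen : ∀ e, 0 ≤ edgeIntegral e fun x => penalty α₀ k e * ‖D.jump v e x‖ ^ 2 := fun e =>
    edgeIntegral_nonneg fun _ _ => mul_nonneg (penalty_nonneg hα _) (sq_nonneg _)
  have key : D.fluxTerm c u v ^ 2 ≤
      (∑ e ∈ D.fluxEdges, 8 * Θ ^ 2 * ϱ ^ 2 / α₀ * g e) * D.jumpSq α₀ k v := by
    refine Finset.sum_sq_le_sum_mul_sum_of_sq_le_mul _
      (fun e _ => mul_nonneg (by positivity) (hg e)) (fun e _ => hpen e) fun e he => ?_
    have hcard := card_eq_two_of_mem_edges (fluxEdges_subset he)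
    have hlen := edgeLength_pos hcard
    have hcs : Continuous fun x => ∑ T ∈ D.mesh.cellsAt e, ‖pgrad (u T) x‖ ^ 2 :=
      continuous_finsetSum _ fun _ _ => continuous_norm_pgrad_sq _
    have hj : Continuous fun x => ‖D.jump v e x‖ ^ 2 := (continuous_jump v e).norm.pow 2
    have h1 : edgeIntegral e (fun x => inner ℝ (D.avgFlux c u e x) (D.jump v e x)) ^ 2 ≤
        edgeIntegral e (fun x => 4 * Θ ^ 2 * ∑ T ∈ D.mesh.cellsAt e, ‖pgrad (u T) x‖ ^ 2) *
          edgeIntegral e (fun x => ‖D.jump v e x‖ ^ 2) := by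
      refine sq_edgeIntegral_le_mul (integrableOn_edge hcard (hcs.const_mul _))
        (integrableOn_edge hcard hj) (fun x _ => by positivity) (fun x _ => by positivity)
        fun x hx => (sq_inner_le _ _).trans ?_
      exact mul_le_mul_of_nonneg_right (norm_avgFlux_sq_le hθ hc hx) (sq_nonneg _)
    have h2 : edgeLength e *
        edgeIntegral e (fun x => ∑ T ∈ D.mesh.cellsAt e, ‖pgrad (u T) x‖ ^ 2) ≤
          2 * ϱ ^ 2 * (k : ℝ) ^ 2 * g e := by
      have : edgeIntegral e (fun x => ∑ T ∈ D.mesh.cellsAt e, ‖pgrad (u T) x‖ ^ 2) =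
          ∑ T ∈ D.mesh.cellsAt e, edgeIntegral e fun x => ‖pgrad (u T) x‖ ^ 2 :=
        integral_finsetSum _ fun T _ => integrableOn_edge hcard (continuous_norm_pgrad_sq _)
      rw [this, Finset.mul_sum, Finset.mul_sum]
      refine Finset.sum_le_sum fun T hT => ?_
      obtain ⟨hT, heT⟩ := mem_cellsAt.1 hT
      obtain ⟨x, r, hr, hball, hdiam⟩ := hρ T hT
      exact edge_trace_pgrad_le (D.mesh.card_eq T hT) hcard heT (hu T hT) hr hball hdiam
    rw [edgeIntegral_const_mul] at h1 ⊢
    set I := edgeIntegral e (fun x => ∑ T ∈ D.mesh.cellsAt e, ‖pgrad (u T) x‖ ^ 2)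
    set J := edgeIntegral e (fun x => ‖D.jump v e x‖ ^ 2)
    have hJ : 0 ≤ J := edgeIntegral_nonneg fun _ _ => sq_nonneg _
    have h3 : I ≤ 2 * ϱ ^ 2 * (k : ℝ) ^ 2 * g e / edgeLength e := by
      rw [le_div_iff₀ hlen]; linarith
    calc _ ≤ 4 * Θ ^ 2 * I * J := h1
      _ ≤ 4 * Θ ^ 2 * (2 * ϱ ^ 2 * (k : ℝ) ^ 2 * g e / edgeLength e) * J :=
        mul_le_mul_of_nonneg_right (mul_le_mul_of_nonneg_left h3 (by positivity)) hJ
      _ = _ := by rw [penalty]; field_simp; ring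
  refine key.trans (mul_le_mul_of_nonneg_right ?_ (jumpSq_nonneg hα))
  rw [← Finset.mul_sum]
  calc _ ≤ 8 * Θ ^ 2 * ϱ ^ 2 / α₀ * (3 * D.gradSq u) :=
        mul_le_mul_of_nonneg_left sum_cellsAt_le (by positivity)
    _ = _ := by ring

theorem sq_penaltyTerm_le (hα : 0 < α₀) :
    (∑ e ∈ D.fluxEdges, edgeIntegral e fun x =>
      penalty α₀ k e * inner ℝ (D.jump u e x) (D.jump v e x)) ^ 2
      ≤ D.jumpSq α₀ k u * D.jumpSq α₀ k v := by
  have hpen : ∀ (w : Finset Plane → MvPolynomial (Fin 2) ℝ) (e : Finset Plane) (x : Plane),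
      0 ≤ penalty α₀ k e * ‖D.jump w e x‖ ^ 2 := fun w e x =>
    mul_nonneg (penalty_nonneg hα _) (sq_nonneg _)
  refine Finset.sum_sq_le_sum_mul_sum_of_sq_le_mul _
    (fun e _ => edgeIntegral_nonneg fun _ _ => hpen _ _ _)
    (fun e _ => edgeIntegral_nonneg fun _ _ => hpen _ _ _) fun e he => ?_
  have hcard := card_eq_two_of_mem_edges (fluxEdges_subset he)
  have hi : ∀ w, IntegrableOn (fun x => penalty α₀ k e * ‖D.jump w e x‖ ^ 2) (hull e)
      (Measure.hausdorffMeasure 1) := fun w =>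
    integrableOn_edge hcard (((continuous_jump w e).norm.pow 2).const_mul _)
  refine sq_edgeIntegral_le_mul (hi u) (hi v) (fun x _ => hpen _ _ _) (fun x _ => hpen _ _ _)
    fun x _ => ?_
  rw [mul_pow]
  calc _ ≤ penalty α₀ k e ^ 2 * (‖D.jump u e x‖ ^ 2 * ‖D.jump v e x‖ ^ 2) :=
        mul_le_mul_of_nonneg_left (sq_inner_le _ _) (sq_nonneg _)
    _ = _ := by ring

theorem sq_barrierTerm_le (hc : c.Admissible D θ Θ) :
    (∑ e ∈ D.γ₁.edges, edgeIntegral e fun x =>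
      c.kb x / c.a x * inner ℝ (D.jump u e x) (D.jump v e x)) ^ 2
      ≤ D.barrierSq c u * D.barrierSq c v := by
  have hnn : ∀ (w : Finset Plane → MvPolynomial (Fin 2) ℝ), ∀ e ∈ D.γ₁.edges, ∀ x ∈ hull e,
      0 ≤ c.kb x / c.a x * ‖D.jump w e x‖ ^ 2 := fun w e he x hx =>
    mul_nonneg (kb_div_a_nonneg hc he hx) (sq_nonneg _)
  refine Finset.sum_sq_le_sum_mul_sum_of_sq_le_mul _
    (fun e he => edgeIntegral_nonneg (hnn _ e he))
    (fun e he => edgeIntegral_nonneg (hnn _ e he)) fun e he => ?_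
  have hi : ∀ w, IntegrableOn (fun x => c.kb x / c.a x * ‖D.jump w e x‖ ^ 2) (hull e)
      (Measure.hausdorffMeasure 1) := fun w =>
    (hc.kb_div_a e he).mul_continuousOn ((continuous_jump w e).norm.pow 2).continuousOn
      (isCompact_hull e)
  refine sq_edgeIntegral_le_mul (hi u) (hi v) (hnn _ e he) (hnn _ e he) fun x _ => ?_
  rw [mul_pow]
  calc _ ≤ (c.kb x / c.a x) ^ 2 * (‖D.jump u e x‖ ^ 2 * ‖D.jump v e x‖ ^ 2) :=
        mul_le_mul_of_nonneg_left (sq_inner_le _ _) (sq_nonneg _)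
    _ = _ := by ring

variable {cell : Plane × Plane → Finset Plane}

theorem abs_akf_le (hθ : 0 < θ) (hc : c.Admissible D θ Θ) {x : Plane} (hx : x ∈ D.γ₂.carrier) :
    |c.a x * c.kf x| ≤ Θ :=
  abs_le.2 ⟨by linarith [hc.akf_lower x hx, hc.akf_upper x hx], hc.akf_upper x hx⟩

theorem sq_akf_le (hθ : 0 < θ) (hc : c.Admissible D θ Θ) {x : Plane} (hx : x ∈ D.γ₂.carrier) :
    (c.a x * c.kf x) ^ 2 ≤ Θ ^ 2 := by
  rw [← sq_abs]; exact pow_le_pow_left₀ (abs_nonneg _) (abs_akf_le hθ hc hx) 2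

theorem sq_fractureTerm_le (hθ : 0 < θ) (hc : c.Admissible D θ Θ) :
    (∑ o ∈ D.γ₂.dirEdges, edgeIntegral (edgeOf o) fun x =>
      c.a x * c.kf x * tderiv o (u (cell o)) x * tderiv o (v (cell o)) x) ^ 2
      ≤ (Θ ^ 2 * D.tangentialSq cell u) * D.tangentialSq cell v := by
  have hsum : Θ ^ 2 * D.tangentialSq cell u = ∑ o ∈ D.γ₂.dirEdges,
      Θ ^ 2 * edgeIntegral (edgeOf o) fun x => tderiv o (u (cell o)) x ^ 2 := Finset.mul_sum ..
  rw [hsum]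
  refine Finset.sum_sq_le_sum_mul_sum_of_sq_le_mul _
    (fun o _ => mul_nonneg (sq_nonneg _) (edgeIntegral_nonneg fun _ _ => sq_nonneg _))
    (fun o _ => edgeIntegral_nonneg fun _ _ => sq_nonneg _) fun o ho => ?_
  have hcard := card_edgeOf ho
  rw [← edgeIntegral_const_mul _ (Θ ^ 2)]
  refine sq_edgeIntegral_le_mul
    (integrableOn_edge hcard ((continuous_tderiv_sq _ _).const_mul _))
    (integrableOn_edge hcard (continuous_tderiv_sq _ _))
    (fun x _ => by positivity) (fun x _ => by positivity) fun x hx => ?_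
  rw [mul_pow, mul_pow]
  exact mul_le_mul_of_nonneg_right (mul_le_mul_of_nonneg_right
    (sq_akf_le hθ hc (hull_subset_carrier ho hx)) (sq_nonneg _)) (sq_nonneg _)

theorem le_fractureTerm (hθ : 0 < θ) (hc : c.Admissible D θ Θ) :
    θ * D.tangentialSq cell u ≤ ∑ o ∈ D.γ₂.dirEdges, edgeIntegral (edgeOf o) fun x =>
      c.a x * c.kf x * tderiv o (u (cell o)) x * tderiv o (u (cell o)) x := by
  rw [tangentialSq, Finset.mul_sum]
  refine Finset.sum_le_sum fun o ho => ?_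
  have hcard := card_edgeOf ho
  rw [← edgeIntegral_const_mul]
  have e : ∀ x, c.a x * c.kf x * tderiv o (u (cell o)) x * tderiv o (u (cell o)) x
      = c.a x * c.kf x * tderiv o (u (cell o)) x ^ 2 := fun x => by ring
  simp only [e]
  refine edgeIntegral_mono
    (integrableOn_edge hcard ((continuous_tderiv_sq _ _).const_mul _))
    (integrableOn_edge_of_bounded hcard (w := fun x => c.a x * c.kf x)
      (hc.measurable_a.mul hc.measurable_kf)
      (fun x hx => abs_akf_le hθ hc (hull_subset_carrier ho hx)) (continuous_tderiv_sq _ _))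
    fun x hx => ?_
  exact mul_le_mul_of_nonneg_right (hc.akf_lower x (hull_subset_carrier ho hx)) (sq_nonneg _)

theorem sq_vertexPenalty_le (hα : 0 < α₀') :
    D.vertexPenalty α₀' k cell u v ^ 2
      ≤ D.vertexPenalty α₀' k cell u u * D.vertexPenalty α₀' k cell v v := by
  have h1 : ∀ w p, 0 ≤ penaltyJoint α₀' k p * jumpJoint cell w p * jumpJoint cell w p :=
    fun w p => by rw [mul_assoc]; exact mul_nonneg (penaltyJoint_nonneg hα p) (mul_self_nonneg _)
  have h2 : ∀ w p, 0 ≤ penaltyTip α₀' k p * D.jumpTip cell w p * D.jumpTip cell w p :=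
    fun w p => by rw [mul_assoc]; exact mul_nonneg (penaltyTip_nonneg hα p) (mul_self_nonneg _)
  refine add_sq_le_add_mul_add (Finset.sum_nonneg fun _ _ => h1 _ _)
    (Finset.sum_nonneg fun _ _ => h2 _ _) (Finset.sum_nonneg fun _ _ => h1 _ _)
    (Finset.sum_nonneg fun _ _ => h2 _ _) ?_ ?_
  · exact Finset.sum_sq_le_sum_mul_sum_of_sq_le_mul _ (fun _ _ => h1 _ _) (fun _ _ => h1 _ _)
      fun p _ => le_of_eq (by ring)
  · exact Finset.sum_sq_le_sum_mul_sum_of_sq_le_mul _ (fun _ _ => h2 _ _) (fun _ _ => h2 _ _)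
      fun p _ => le_of_eq (by ring)

open scoped Classical in
theorem mem_joints {p : (Plane × Plane) × (Plane × Plane)} : p ∈ D.γ₂.joints ↔
    p.1 ∈ D.γ₂.dirEdges ∧ p.2 ∈ D.γ₂.dirEdges ∧ p.1.2 = p.2.1 ∧ p.1.2 ∈ D.Ω := by
  rw [MeshCurve.joints, Finset.mem_filter, Finset.mem_product, and_assoc]

open scoped Classical in
theorem mem_tips {p : (Plane × Plane) × Plane} : p ∈ D.γ₂.tips D.ΓD →
    p.1 ∈ D.γ₂.dirEdges ∧ p.2 ∈ edgeOf p.1 := by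
  intro h
  obtain ⟨o, ho, hp⟩ := Finset.mem_biUnion.1 (Finset.mem_filter.1 h).1
  obtain ⟨P, hP, rfl⟩ := Finset.mem_image.1 hp
  exact ⟨ho, hP⟩

theorem sum_joints_fst_le {G : Plane × Plane → ℝ} (hG : ∀ o, 0 ≤ G o) :
    ∑ p ∈ D.γ₂.joints, G p.1 ≤ ∑ o ∈ D.γ₂.dirEdges, G o := by
  classical
  have hinj : Set.InjOn Prod.fst (D.γ₂.joints : Set ((Plane × Plane) × (Plane × Plane))) := by
    intro p hp q hq h
    obtain ⟨hp1, hp2, hp3, hp4⟩ := mem_joints.1 hp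
    obtain ⟨hq1, hq2, hq3, hq4⟩ := mem_joints.1 hq
    have := (D.γ₂.inner p.1 hp1 p.1.2 (by simp [edgeOf]) hp4).2.unique
      ⟨hp2, hp3.symm⟩ ⟨hq2, by rw [← hq3, h]⟩
    exact Prod.ext h this
  rw [← Finset.sum_image (f := G) hinj]
  refine Finset.sum_le_sum_of_subset_of_nonneg ?_ fun o _ _ => hG o
  intro o ho
  obtain ⟨p, hp, rfl⟩ := Finset.mem_image.1 ho
  exact (mem_joints.1 hp).1

theorem sum_joints_snd_le {G : Plane × Plane → ℝ} (hG : ∀ o, 0 ≤ G o) :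
    ∑ p ∈ D.γ₂.joints, G p.2 ≤ ∑ o ∈ D.γ₂.dirEdges, G o := by
  classical
  have hinj : Set.InjOn Prod.snd (D.γ₂.joints : Set ((Plane × Plane) × (Plane × Plane))) := by
    intro p hp q hq h
    obtain ⟨hp1, hp2, hp3, hp4⟩ := mem_joints.1 hp
    obtain ⟨hq1, hq2, hq3, hq4⟩ := mem_joints.1 hq
    have := (D.γ₂.inner p.1 hp1 p.1.2 (by simp [edgeOf]) hp4).1.unique
      ⟨hp1, rfl⟩ ⟨hq1, by rw [hq3, hp3, h]⟩
    exact Prod.ext this h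
  rw [← Finset.sum_image (f := G) hinj]
  refine Finset.sum_le_sum_of_subset_of_nonneg ?_ fun o _ _ => hG o
  intro o ho
  obtain ⟨p, hp, rfl⟩ := Finset.mem_image.1 ho
  exact (mem_joints.1 hp).2.1

theorem sum_tips_fst_le {G : Plane × Plane → ℝ} (hG : ∀ o, 0 ≤ G o) :
    ∑ p ∈ D.γ₂.tips D.ΓD, G p.1 ≤ 2 * ∑ o ∈ D.γ₂.dirEdges, G o := by
  classical
  rw [← Finset.sum_fiberwise_of_maps_to (s := D.γ₂.tips D.ΓD) (t := D.γ₂.dirEdges) (g := Prod.fst)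
    (fun p hp => (mem_tips hp).1), Finset.mul_sum]
  refine Finset.sum_le_sum fun o ho => ?_
  have h1 : ∀ p ∈ (D.γ₂.tips D.ΓD).filter (fun p => p.1 = o), G p.1 = G o := fun p hp => by
    rw [(Finset.mem_filter.1 hp).2]
  rw [Finset.sum_congr rfl h1, Finset.sum_const, nsmul_eq_mul]
  refine mul_le_mul_of_nonneg_right ?_ (hG o)
  have h2 : (D.γ₂.tips D.ΓD).filter (fun p => p.1 = o) ⊆ (edgeOf o).image fun P => (o, P) := by
    intro p hp
    obtain ⟨hp', rfl⟩ := Finset.mem_filter.1 hp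
    exact Finset.mem_image.2 ⟨p.2, (mem_tips hp').2, rfl⟩
  have h3 := (Finset.card_le_card h2).trans Finset.card_image_le
  rw [card_edgeOf ho] at h3
  exact_mod_cast h3

open scoped Classical in
theorem sq_tderiv_le {γ : MeshCurve D.mesh} {p : MvPolynomial (Fin 2) ℝ} (hp : p.totalDegree ≤ k)
    {o : Plane × Plane} (ho : o ∈ γ.dirEdges) {P : Plane} (hP : P ∈ edgeOf o) :
    tderiv o p P ^ 2 ≤ (k : ℝ) ^ 2 / edgeLength (edgeOf o) *
      edgeIntegral (edgeOf o) fun x => tderiv o p x ^ 2 := by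
  have hne : o.1 ≠ o.2 := fun h => by
    have := card_edgeOf ho
    rw [edgeOf, h, Finset.pair_eq_singleton, Finset.card_singleton] at this
    omega
  exact sq_endpoint_le (lineDegreeLT_tderiv hp o) hne (by simpa [edgeOf] using hP)

theorem sq_vertexFlux_le (hθ : 0 < θ) (hc : c.Admissible D θ Θ)
    (hcell : ∀ o ∈ D.γ₂.dirEdges, cell o ∈ D.mesh.cells) (hα : 0 < α₀')
    (hu : u ∈ D.mesh.DGSpace k) :
    D.vertexFlux c cell u v ^ 2 ≤
      (3 * Θ ^ 2 / α₀' * D.tangentialSq cell u) * D.vertexPenalty α₀' k cell v v := by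
  classical
  let G : Plane × Plane → ℝ := fun o =>
    edgeIntegral (edgeOf o) fun x => tderiv o (u (cell o)) x ^ 2
  have hG : ∀ o, 0 ≤ G o := fun o => edgeIntegral_nonneg fun _ _ => sq_nonneg _
  have hk : (0 : ℝ) ≤ (k : ℝ) ^ 2 := sq_nonneg _
  have hJ : ∀ p, 0 ≤ penaltyJoint α₀' k p * jumpJoint cell v p * jumpJoint cell v p :=
    fun p => by rw [mul_assoc]; exact mul_nonneg (penaltyJoint_nonneg hα p) (mul_self_nonneg _)
  have hT : ∀ p, 0 ≤ penaltyTip α₀' k p * D.jumpTip cell v p * D.jumpTip cell v p :=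
    fun p => by rw [mul_assoc]; exact mul_nonneg (penaltyTip_nonneg hα p) (mul_self_nonneg _)
  have hsplit : 3 * Θ ^ 2 / α₀' * D.tangentialSq cell u =
      Θ ^ 2 / α₀' * D.tangentialSq cell u + 2 * Θ ^ 2 / α₀' * D.tangentialSq cell u := by ring
  have ht := tangentialSq_nonneg (D := D) (v := u) (cell := cell)
  rw [hsplit]
  refine add_sq_le_add_mul_add (by positivity) (by positivity)
    (Finset.sum_nonneg fun _ _ => hJ _) (Finset.sum_nonneg fun _ _ => hT _) ?_ ?_
  · refine (Finset.sum_sq_le_sum_mul_sum_of_sq_le_mul _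
      (f := fun p => Θ ^ 2 / α₀' * ((G p.1 + G p.2) / 2))
      (fun p _ => mul_nonneg (by positivity) (by linarith [hG p.1, hG p.2]))
      (fun p _ => hJ p) fun p hp => ?_).trans
      (mul_le_mul_of_nonneg_right ?_ (Finset.sum_nonneg fun _ _ => hJ _))
    · obtain ⟨h1, h2, h3, h4⟩ := mem_joints.1 hp
      have hP1 : p.1.2 ∈ edgeOf p.1 := by simp [edgeOf]
      have hP2 : p.1.2 ∈ edgeOf p.2 := by simp [edgeOf, h3]
      have t1 := sq_tderiv_le (hu _ (hcell _ h1)) h1 hP1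
      have t2 := sq_tderiv_le (hu _ (hcell _ h2)) h2 hP2
      set m := min (edgeLength (edgeOf p.1)) (edgeLength (edgeOf p.2)) with hm_def
      have hm : 0 < m := lt_min (edgeLength_pos (card_edgeOf h1)) (edgeLength_pos (card_edgeOf h2))
      have t1' := t1.trans (mul_le_mul_of_nonneg_right
        (div_le_div_of_nonneg_left hk hm (min_le_left _ _)) (hG p.1))
      have t2' := t2.trans (mul_le_mul_of_nonneg_right
        (div_le_div_of_nonneg_left hk hm (min_le_right _ _)) (hG p.2))
      have havg : avgJoint cell u p ^ 2 ≤ (k : ℝ) ^ 2 / m * ((G p.1 + G p.2) / 2) := by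
        rw [avgJoint]
        nlinarith [sq_nonneg (tderiv p.1 (u (cell p.1)) p.1.2 - tderiv p.2 (u (cell p.2)) p.1.2)]
      have hakf := sq_akf_le hθ hc (hull_subset_carrier h1 (subset_convexHull _ _ hP1))
      rw [mul_pow, mul_pow]
      calc _ ≤ Θ ^ 2 * ((k : ℝ) ^ 2 / m * ((G p.1 + G p.2) / 2)) * jumpJoint cell v p ^ 2 :=
            mul_le_mul_of_nonneg_right (mul_le_mul hakf havg (sq_nonneg _) (sq_nonneg _))
              (sq_nonneg _)
        _ = _ := by rw [penaltyJoint, ← hm_def]; field_simp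
    · rw [← Finset.mul_sum, ← Finset.sum_div, Finset.sum_add_distrib]
      have h1 := sum_joints_fst_le (D := D) hG
      have h2 := sum_joints_snd_le (D := D) hG
      refine mul_le_mul_of_nonneg_left ?_ (by positivity)
      rw [tangentialSq]
      linarith
  · refine (Finset.sum_sq_le_sum_mul_sum_of_sq_le_mul _
      (f := fun p : (Plane × Plane) × Plane => Θ ^ 2 / α₀' * G p.1)
      (fun p _ => mul_nonneg (div_nonneg (sq_nonneg Θ) hα.le) (hG p.1))
      (fun p _ => hT p) fun p hp => ?_).trans
      (mul_le_mul_of_nonneg_right ?_ (Finset.sum_nonneg fun _ _ => hT _))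
    · obtain ⟨h1, hP⟩ := mem_tips hp
      have t1 : avgTip cell u p ^ 2 ≤ (k : ℝ) ^ 2 / edgeLength (edgeOf p.1) * G p.1 :=
        sq_tderiv_le (hu _ (hcell _ h1)) h1 hP
      have hlen := edgeLength_pos (card_edgeOf h1)
      have hakf := sq_akf_le hθ hc (hull_subset_carrier h1 (subset_convexHull _ _ hP))
      rw [mul_pow, mul_pow]
      calc _ ≤ Θ ^ 2 * ((k : ℝ) ^ 2 / edgeLength (edgeOf p.1) * G p.1) * D.jumpTip cell v p ^ 2 :=
            mul_le_mul_of_nonneg_right (mul_le_mul hakf t1 (sq_nonneg _) (sq_nonneg _))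
              (sq_nonneg _)
        _ = _ := by rw [penaltyTip]; field_simp
    · rw [← Finset.mul_sum]
      calc _ ≤ Θ ^ 2 / α₀' * (2 * D.tangentialSq cell u) :=
            mul_le_mul_of_nonneg_left (sum_tips_fst_le hG) (by positivity)
        _ = _ := by ring

end FracturedMesh

/-! ### Continuity and coercivity -/

theorem abs_le_mul_of_sq_le {t C X Y : ℝ} (hC : 0 ≤ C) (hX : 0 ≤ X) (hY : 0 ≤ Y)
    (h : t ^ 2 ≤ (C ^ 2 * X) * Y) : |t| ≤ C * (√X * √Y) := by
  refine abs_le_of_sq_le_sq ?_ (by positivity)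
  rw [mul_pow, mul_pow, Real.sq_sqrt hX, Real.sq_sqrt hY]
  linarith

namespace FracturedMesh

variable {D : FracturedMesh} {c : Coefficients} {θ Θ ϱ σ α₀ α₀' : ℝ} {k : ℕ}
  {u v : Finset Plane → MvPolynomial (Fin 2) ℝ} {cell : Plane × Plane → Finset Plane}

theorem sq_fluxTerm_le_of_large (hθ : 0 < θ) (hc : c.Admissible D θ Θ)
    (hρ : D.mesh.ShapeRegular ϱ) (hα : 96 * Θ ^ 2 * ϱ ^ 2 / θ + 1 ≤ α₀)
    (hu : u ∈ D.mesh.DGSpace k) :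
    D.fluxTerm c u v ^ 2 ≤ (θ / 4 * D.gradSq u) * D.jumpSq α₀ k v := by
  have h0 : 0 < α₀ := lt_of_lt_of_le (by positivity) hα
  refine (sq_fluxTerm_le hθ hc hρ h0 hu).trans (mul_le_mul_of_nonneg_right
    (mul_le_mul_of_nonneg_right ?_ gradSq_nonneg) (jumpSq_nonneg h0))
  have : 96 * Θ ^ 2 * ϱ ^ 2 / θ ≤ α₀ := by linarith
  rw [div_le_iff₀ hθ] at this
  rw [div_le_iff₀ h0]
  linarith

theorem sq_vertexFlux_le_of_large (hθ : 0 < θ) (hc : c.Admissible D θ Θ)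
    (hcell : ∀ o ∈ D.γ₂.dirEdges, cell o ∈ D.mesh.cells) (hα : 6 * Θ ^ 2 / θ + 1 ≤ α₀')
    (hu : u ∈ D.mesh.DGSpace k) :
    D.vertexFlux c cell u v ^ 2 ≤
      (θ / 2 * D.tangentialSq cell u) * D.vertexPenalty α₀' k cell v v := by
  have h0 : 0 < α₀' := lt_of_lt_of_le (by positivity) hα
  refine (sq_vertexFlux_le hθ hc hcell h0 hu).trans (mul_le_mul_of_nonneg_right
    (mul_le_mul_of_nonneg_right ?_ tangentialSq_nonneg) (vertexPenalty_nonneg h0))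
  have : 6 * Θ ^ 2 / θ ≤ α₀' := by linarith
  rw [div_le_iff₀ hθ] at this
  rw [div_le_iff₀ h0]
  linarith

theorem aForm_eq : D.aForm c σ α₀ k u v =
    (∑ T ∈ D.mesh.cells, ∫ x in hull T, inner ℝ (flux c u T x) (pgrad (v T) x))
    - D.fluxTerm c u v + σ * D.fluxTerm c v u
    + (∑ e ∈ D.fluxEdges, edgeIntegral e fun x =>
        penalty α₀ k e * inner ℝ (D.jump u e x) (D.jump v e x))
    + ∑ e ∈ D.γ₁.edges, edgeIntegral e fun x =>
        c.kb x / c.a x * inner ℝ (D.jump u e x) (D.jump v e x) := by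
  simp only [aForm, fluxTerm, real_inner_comm]

theorem dgNormSq_eq : D.dgNormSq c α₀ α₀' k v = D.gradSq v + D.jumpSq α₀ k v + D.barrierSq c v
    + D.tangentialSq D.cellMinus v + D.tangentialSq D.cellPlus v
    + D.vertexPenalty α₀' k D.cellMinus v v + D.vertexPenalty α₀' k D.cellPlus v v := rfl

theorem abs_sigma_mul_le (hσ : σ = -1 ∨ σ = 0 ∨ σ = 1) (t : ℝ) : |σ * t| ≤ |t| := by
  rw [abs_mul]
  refine mul_le_of_le_one_left (abs_nonneg _) ?_
  rcases hσ with rfl | rfl | rfl <;> simp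

theorem abs_aForm_le (hθ : 0 < θ) (hΘ : 0 < Θ) (hc : c.Admissible D θ Θ)
    (hρ : D.mesh.ShapeRegular ϱ) (hσ : σ = -1 ∨ σ = 0 ∨ σ = 1)
    (hα : 96 * Θ ^ 2 * ϱ ^ 2 / θ + 1 ≤ α₀)
    (hu : u ∈ D.mesh.DGSpace k) (hv : v ∈ D.mesh.DGSpace k) {X Y : ℝ}
    (hX : D.gradSq u + D.jumpSq α₀ k u + D.barrierSq c u ≤ X)
    (hY : D.gradSq v + D.jumpSq α₀ k v + D.barrierSq c v ≤ Y) :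
    |D.aForm c σ α₀ k u v| ≤ (2 * Θ + 2 * (1 + θ) + 2) * (√X * √Y) := by
  have h0 : 0 < α₀ := lt_of_lt_of_le (by positivity) hα
  have g := fun w => gradSq_nonneg (D := D) (v := w)
  have j := fun w => jumpSq_nonneg (D := D) (k := k) (v := w) h0
  have b := fun w => barrierSq_nonneg (v := w) hc
  have hX0 : 0 ≤ X := by linarith [g u, j u, b u]
  have hY0 : 0 ≤ Y := by linarith [g v, j v, b v]
  have gX : D.gradSq u ≤ X := by linarith [j u, b u]
  have jX : D.jumpSq α₀ k u ≤ X := by linarith [g u, b u]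
  have bX : D.barrierSq c u ≤ X := by linarith [j u, g u]
  have gY : D.gradSq v ≤ Y := by linarith [j v, b v]
  have jY : D.jumpSq α₀ k v ≤ Y := by linarith [g v, b v]
  have bY : D.barrierSq c v ≤ Y := by linarith [j v, g v]
  have hq : θ / 4 ≤ (1 + θ) ^ 2 := by nlinarith
  have t1 := abs_le_mul_of_sq_le (C := 2 * Θ) (by positivity) hX0 hY0
    ((sq_bulkTerm_le (u := u) (v := v) hθ hc).trans
      ((mul_le_mul (mul_le_mul_of_nonneg_left gX (by positivity)) gY (g v) (by positivity)).trans
        (le_of_eq (by ring))))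
  have t2 := abs_le_mul_of_sq_le (C := 1 + θ) (by positivity) hX0 hY0
    ((sq_fluxTerm_le_of_large (v := v) hθ hc hρ hα hu).trans
      (mul_le_mul (mul_le_mul hq gX (g u) (by positivity)) jY (j v) (by positivity)))
  have t3 := abs_le_mul_of_sq_le (C := 1 + θ) (by positivity) hY0 hX0
    ((sq_fluxTerm_le_of_large (v := u) hθ hc hρ hα hv).trans
      (mul_le_mul (mul_le_mul hq gY (g v) (by positivity)) jX (j u) (by positivity)))
  have t4 := abs_le_mul_of_sq_le (C := 1) zero_le_one hX0 hY0
    ((sq_penaltyTerm_le (D := D) (u := u) (v := v) (k := k) h0).trans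
      ((mul_le_mul jX jY (j v) hX0).trans (le_of_eq (by ring))))
  have t5 := abs_le_mul_of_sq_le (C := 1) zero_le_one hX0 hY0
    ((sq_barrierTerm_le (u := u) (v := v) hc).trans
      ((mul_le_mul bX bY (b v) hX0).trans (le_of_eq (by ring))))
  have t3' := (abs_sigma_mul_le hσ (D.fluxTerm c v u)).trans t3
  rw [mul_comm √Y] at t3'
  rw [aForm_eq]
  rw [abs_le] at *
  constructor <;> linarith [t1.1, t1.2, t2.1, t2.2, t3'.1, t3'.2, t4.1, t4.2, t5.1, t5.2]

theorem abs_bSide_le (hθ : 0 < θ) (hΘ : 0 < Θ) (hc : c.Admissible D θ Θ)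
    (hcell : ∀ o ∈ D.γ₂.dirEdges, cell o ∈ D.mesh.cells) (hσ : σ = -1 ∨ σ = 0 ∨ σ = 1)
    (hα : 6 * Θ ^ 2 / θ + 1 ≤ α₀')
    (hu : u ∈ D.mesh.DGSpace k) (hv : v ∈ D.mesh.DGSpace k) {X Y : ℝ}
    (hX : D.tangentialSq cell u + D.vertexPenalty α₀' k cell u u ≤ X)
    (hY : D.tangentialSq cell v + D.vertexPenalty α₀' k cell v v ≤ Y) :
    |D.bSide c σ α₀' k cell u v| ≤ (Θ / 2 + (1 + θ) + 1) * (√X * √Y) := by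
  have h0 : 0 < α₀' := lt_of_lt_of_le (by positivity) hα
  have g := fun w => tangentialSq_nonneg (D := D) (v := w) (cell := cell)
  have j := fun w => vertexPenalty_nonneg (D := D) (k := k) (v := w) (cell := cell) h0
  have hX0 : 0 ≤ X := by linarith [g u, j u]
  have hY0 : 0 ≤ Y := by linarith [g v, j v]
  have gX : D.tangentialSq cell u ≤ X := by linarith [j u]
  have jX : D.vertexPenalty α₀' k cell u u ≤ X := by linarith [g u]
  have gY : D.tangentialSq cell v ≤ Y := by linarith [j v]
  have jY : D.vertexPenalty α₀' k cell v v ≤ Y := by linarith [g v]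
  have hq : θ / 2 ≤ (1 + θ) ^ 2 := by nlinarith
  have t1 := abs_le_mul_of_sq_le (C := Θ) hΘ.le hX0 hY0
    ((sq_fractureTerm_le (u := u) (v := v) (cell := cell) hθ hc).trans
      (mul_le_mul (mul_le_mul_of_nonneg_left gX (by positivity)) gY (g v) (by positivity)))
  have t2 := abs_le_mul_of_sq_le (C := 1 + θ) (by positivity) hX0 hY0
    ((sq_vertexFlux_le_of_large (v := v) hθ hc hcell hα hu).trans
      (mul_le_mul (mul_le_mul hq gX (g u) (by positivity)) jY (j v) (by positivity)))
  have t3 := abs_le_mul_of_sq_le (C := 1 + θ) (by positivity) hY0 hX0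
    ((sq_vertexFlux_le_of_large (v := u) hθ hc hcell hα hv).trans
      (mul_le_mul (mul_le_mul hq gY (g v) (by positivity)) jX (j u) (by positivity)))
  have t4 := abs_le_mul_of_sq_le (C := 1) zero_le_one hX0 hY0
    ((sq_vertexPenalty_le (D := D) (u := u) (v := v) (k := k) (cell := cell) h0).trans
      ((mul_le_mul jX jY (j v) hX0).trans (le_of_eq (by ring))))
  have t3' := (abs_sigma_mul_le hσ (D.vertexFlux c cell v u)).trans t3
  rw [mul_comm √Y] at t3'
  rw [bSide]
  rw [abs_le] at *
  constructor <;> linarith [t1.1, t1.2, t2.1, t2.2, t3'.1, t3'.2, t4.1, t4.2]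

theorem le_aForm (hθ : 0 < θ) (hc : c.Admissible D θ Θ)
    (hρ : D.mesh.ShapeRegular ϱ) (hσ : σ = -1 ∨ σ = 0 ∨ σ = 1)
    (hα : 96 * Θ ^ 2 * ϱ ^ 2 / θ + 1 ≤ α₀) (hu : u ∈ D.mesh.DGSpace k) :
    θ / 2 * D.gradSq u + 1 / 2 * D.jumpSq α₀ k u + D.barrierSq c u ≤ D.aForm c σ α₀ k u u := by
  have h0 : 0 < α₀ := lt_of_lt_of_le (by positivity) hα
  have t1 := le_bulkTerm (u := u) hθ hc
  have g := gradSq_nonneg (D := D) (v := u)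
  have t2 := two_mul_abs_le_of_sq_le (mul_nonneg (by positivity) g) (jumpSq_nonneg h0)
    (sq_fluxTerm_le_of_large (v := u) hθ hc hρ hα hu) (ε := 2) two_pos
  have t3 := abs_sigma_mul_le hσ (D.fluxTerm c u u)
  rw [aForm_eq]
  simp only [real_inner_self_eq_norm_sq]
  change _ ≤ _ - _ + _ + D.jumpSq α₀ k u + D.barrierSq c u
  linarith [le_abs_self (D.fluxTerm c u u), neg_abs_le (σ * D.fluxTerm c u u)]

theorem le_bSide (hθ : 0 < θ) (hc : c.Admissible D θ Θ)
    (hcell : ∀ o ∈ D.γ₂.dirEdges, cell o ∈ D.mesh.cells) (hσ : σ = -1 ∨ σ = 0 ∨ σ = 1)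
    (hα : 6 * Θ ^ 2 / θ + 1 ≤ α₀') (hu : u ∈ D.mesh.DGSpace k) :
    θ / 4 * D.tangentialSq cell u + 1 / 2 * D.vertexPenalty α₀' k cell u u ≤
      D.bSide c σ α₀' k cell u u := by
  have h0 : 0 < α₀' := lt_of_lt_of_le (by positivity) hα
  have t1 := le_fractureTerm (u := u) (cell := cell) hθ hc
  have g := tangentialSq_nonneg (D := D) (v := u) (cell := cell)
  have t2 := two_mul_abs_le_of_sq_le (mul_nonneg (by positivity) g) (vertexPenalty_nonneg h0)
    (sq_vertexFlux_le_of_large (v := u) hθ hc hcell hα hu) (ε := 1) one_pos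
  have t3 := abs_sigma_mul_le hσ (D.vertexFlux c cell u u)
  rw [bSide]
  linarith [le_abs_self (D.vertexFlux c cell u u), neg_abs_le (σ * D.vertexFlux c cell u u)]

end FracturedMesh

theorem theorem1 (θ Θ ϱ : ℝ) (hθ : 0 < θ) (hΘ : 0 < Θ) :
    ∃ A A' C₁ C₂ : ℝ, 0 < A ∧ 0 < A' ∧ 0 < C₁ ∧ 0 < C₂ ∧
      ∀ (D : FracturedMesh), D.mesh.ShapeRegular ϱ →
      ∀ (c : Coefficients), c.Admissible D θ Θ →
      ∀ (σ : ℝ), (σ = -1 ∨ σ = 0 ∨ σ = 1) →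
      ∀ (k : ℕ) (α₀ α₀' : ℝ), A ≤ α₀ → A' ≤ α₀' →
        (∀ u ∈ D.mesh.DGSpace k, ∀ v ∈ D.mesh.DGSpace k,
          |D.aForm c σ α₀ k u v + D.bForm c σ α₀' k u v| ≤
            C₁ * D.dgNorm c α₀ α₀' k u * D.dgNorm c α₀ α₀' k v) ∧
        (∀ u ∈ D.mesh.DGSpace k,
          C₂ * D.dgNorm c α₀ α₀' k u ^ 2 ≤
            D.aForm c σ α₀ k u u + D.bForm c σ α₀' k u u) := by
  refine ⟨96 * Θ ^ 2 * ϱ ^ 2 / θ + 1, 6 * Θ ^ 2 / θ + 1, 3 * Θ + 4 * θ + 8, min (θ / 4) (1 / 2),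
    by positivity, by positivity, by positivity, by positivity, ?_⟩
  intro D hρ c hc σ hσ k α₀ α₀' hα hα'
  have h0 : 0 < α₀ := lt_of_lt_of_le (by positivity) hα
  have h0' : 0 < α₀' := lt_of_lt_of_le (by positivity) hα'
  have hminus : ∀ o ∈ D.γ₂.dirEdges, D.cellMinus o ∈ D.mesh.cells := fun o ho =>
    (FracturedMesh.mem_cellsAt.1 (D.cellMinus_spec o ho).1).1
  have hplus : ∀ o ∈ D.γ₂.dirEdges, D.cellPlus o ∈ D.mesh.cells := fun o ho =>
    (FracturedMesh.mem_cellsAt.1 (D.cellPlus_spec o ho).1).1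
  have g := fun w => FracturedMesh.gradSq_nonneg (D := D) (v := w)
  have j := fun w => FracturedMesh.jumpSq_nonneg (D := D) (k := k) (v := w) h0
  have b := fun w => FracturedMesh.barrierSq_nonneg (v := w) hc
  have t := fun w cell => FracturedMesh.tangentialSq_nonneg (D := D) (v := w) (cell := cell)
  have p := fun w cell =>
    FracturedMesh.vertexPenalty_nonneg (D := D) (k := k) (v := w) (cell := cell) h0'
  have hdg := fun w => FracturedMesh.dgNormSq_eq (D := D) (c := c) (α₀ := α₀) (α₀' := α₀') (k := k)
    (v := w)
  have hg : ∀ w, D.gradSq w + D.jumpSq α₀ k w + D.barrierSq c w ≤ D.dgNormSq c α₀ α₀' k w :=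
    fun w => by
      linarith [hdg w, t w D.cellMinus, t w D.cellPlus, p w D.cellMinus, p w D.cellPlus]
  have hm : ∀ w, D.tangentialSq D.cellMinus w + D.vertexPenalty α₀' k D.cellMinus w w ≤
      D.dgNormSq c α₀ α₀' k w := fun w => by
    linarith [hdg w, t w D.cellPlus, p w D.cellPlus, g w, j w, b w]
  have hp : ∀ w, D.tangentialSq D.cellPlus w + D.vertexPenalty α₀' k D.cellPlus w w ≤
      D.dgNormSq c α₀ α₀' k w := fun w => by
    linarith [hdg w, t w D.cellMinus, p w D.cellMinus, g w, j w, b w]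
  refine ⟨fun u hu v hv => ?_, fun u hu => ?_⟩
  · have ha := FracturedMesh.abs_aForm_le hθ hΘ hc hρ hσ hα hu hv (hg u) (hg v)
    have hb := FracturedMesh.abs_bSide_le hθ hΘ hc hminus hσ hα' hu hv (hm u) (hm v)
    have hb' := FracturedMesh.abs_bSide_le hθ hΘ hc hplus hσ hα' hu hv (hp u) (hp v)
    rw [FracturedMesh.bForm, FracturedMesh.dgNorm, FracturedMesh.dgNorm]
    have := (abs_add_le (D.aForm c σ α₀ k u v) _).trans (add_le_add ha
      ((abs_add_le _ _).trans (add_le_add hb hb')))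
    refine this.trans (le_of_eq ?_)
    ring
  · have hnn : 0 ≤ D.dgNormSq c α₀ α₀' k u := by linarith [hg u, g u, j u, b u]
    have ha := FracturedMesh.le_aForm hθ hc hρ hσ hα hu
    have hb := FracturedMesh.le_bSide hθ hc hminus hσ hα' hu
    have hb' := FracturedMesh.le_bSide hθ hc hplus hσ hα' hu
    rw [FracturedMesh.dgNorm, Real.sq_sqrt hnn, hdg, FracturedMesh.bForm]
    set C := min (θ / 4) (1 / 2)
    have c1 : C ≤ θ / 4 := min_le_left _ _
    have c2 : C ≤ 1 / 2 := min_le_right _ _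
    linarith [mul_le_mul_of_nonneg_right (c1.trans (by linarith : θ / 4 ≤ θ / 2)) (g u),
      mul_le_mul_of_nonneg_right c2 (j u),
      mul_le_mul_of_nonneg_right (c2.trans (by norm_num : (1 / 2 : ℝ) ≤ 1)) (b u),
      mul_le_mul_of_nonneg_right c1 (t u D.cellMinus),
      mul_le_mul_of_nonneg_right c1 (t u D.cellPlus),
      mul_le_mul_of_nonneg_right c2 (p u D.cellMinus),
      mul_le_mul_of_nonneg_right c2 (p u D.cellPlus)]
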